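/- Positive logic. A formula is a positive existential formula (built from atomic formulas, including equality, by $\wedge,\vee,\top,\bot,\exists$); a theory is a set of h-inductive sentences $\forall x(\varphi(x)\to\psi(x))$ with $\varphi,\psi$ formulas. Tuples may be infinite; "small" means of cardinality $<\bar\kappa$. Let $T$ be a theory with the joint embedding property in a one-sorted signature $\mathcal L$, with monster model $\mathfrak M$: an existentially closed model of $T$ in which every partial immersion between small sets extends to an automorphism, and every finitely satisfiable small set of formulas over $\mathfrak M$ is satisfiable. A partial type in $T$ is a set of formulas consistent with $T$, a type in $T$ is a maximal such set, and $\operatorname{tp}(a)$ is the set of formulas without parameters true of $a$ in the monster model. Variables range over small tuples. Call $T$ * *Hausdorff* if for any two distinct types $p(x),q(x)$ there are $\varphi\notin p$ and $\psi\notin q$ with $\mathfrak M\models\forall x(\varphi(x)\vee\psi(x))$; * *semi-Hausdorff* if for every tuple of variables $x$ there is a partial type $\Omega(x,y)$ such that $\operatorname{tp}(a)=\operatorname{tp}(b)$ if and only if $\mathfrak M\models\Omega(a,b)$; * *thick* if for every tuple of variables $x$ there is a partial type $\Theta((x_i)_{i<\omega})$ such that $(a_i)_{i<\omega}$ is indiscernible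 if and only if $\mathfrak M\models\Theta((a_i)_{i<\omega})$. Let $\mathcal E$ be a set of partial types $E(x,y)$ without parameters, with $x,y$ tuples of the same small length depending on $E$, each defining an equivalence relation in $\mathfrak M$. Let $\mathcal L_{\mathcal E}$ be the many-sorted extension of $\mathcal L$ that has, besides the real sort of $\mathcal L$, a sort $S_E$ for each $E\in\mathcal E$, and a relation symbol $R_\varphi(x,y_1,\dots,y_m)$ for all $E_1,\dots,E_m\in\mathcal E$ and each $\mathcal L$-formula $\varphi(x,y_{1,r},\dots,y_{m,r})$, where $x$ is a finite real tuple, $y_j$ has sort $S_{E_j}$ and $y_{j,r}$ is a tuple of real variables of the length of the representatives of $E_j$-classes. Let $\mathfrak M^{\mathcal E}$ be the $\mathcal L_{\mathcal E}$-structure with real sort $\mathfrak M$ and $S_E=\mathfrak M^{|x|}/E$ in which $R_\varphi(a,c_1,\dots,c_m)$ holds if and only if $\mathfrak M\models\varphi(a,b_1,\dots,b_m)$ for some representatives $b_j$ of $c_j$. Let $T^{\mathcal E}$, the hyperimaginary extension of $T$, be the set of all h-inductive $\mathcal L_{\mathcal E}$-sentences true in $\mathfrak M^{\mathcal E}$;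 its properties are evaluated with $\mathfrak M^{\mathcal E}$ in the role of the monster model. Assume that $\bar\kappa$ is sufficiently large, namely $\bar\kappa>\beth_{(2^\mu)^+}$ for some infinite cardinal $\mu$ that is at least the number of symbols of $\mathcal L$ and at least the length of the tuples $x$ in each $E(x,y)\in\mathcal E$. If $T$ is Hausdorff (respectively semi-Hausdorff, thick), then so is $T^{\mathcal E}$. -/

import Mathlib

open Cardinal

universe u w

namespace PosLogic

/-- A many-sorted signature with set of sorts `S`. Arities are finite and indexed by finite types.
Equality is a logical symbol, available in every sort. -/
structure Signature (S : Type u) where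
  /-- function symbols -/
  Func : Type u
  /-- the finite set of argument places of a function symbol -/
  FuncArg : Func → Type
  finite_funcArg : ∀ f, Finite (FuncArg f)
  /-- the sorts of the arguments -/
  dom : ∀ f, FuncArg f → S
  /-- the sort of the value -/
  cod : Func → S
  /-- relation symbols -/
  Rel : Type u
  /-- the finite set of argument places of a relation symbol -/
  RelArg : Rel → Type
  finite_relArg : ∀ R, Finite (RelArg R)
  /-- the sorts of the arguments -/
  rdom : ∀ R, RelArg R → S

variable {S : Type u}

/-- Terms whose variables are the elements `x` of `X`, the variable `x` being of sort `σ x`. -/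
inductive Term (L : Signature S) {X : Type w} (σ : X → S) : S → Type (max u w)
  | var (x : X) : Term L σ (σ x)
  | app (f : L.Func) (ts : ∀ i : L.FuncArg f, Term L σ (L.dom f i)) : Term L σ (L.cod f)

/-- Sorts of the variables when the free variables `X` are joined by a list `Γ` of bound ones. -/
abbrev ctx {X : Type w} (σ : X → S) (Γ : List S) : X ⊕ Fin Γ.length → S :=
  Sum.elim σ Γ.get

/-- Positive existential formulas with free variables in `X` (sorted by `σ`) and de Bruijn bound
variables, whose sorts are listed in `Γ`. -/
inductive BFormula (L : Signature S) {X : Type w} (σ : X → S) : List S → Type (max u w)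
  | top {Γ : List S} : BFormula L σ Γ
  | bot {Γ : List S} : BFormula L σ Γ
  | equal {Γ : List S} {s : S} (t₁ t₂ : Term L (ctx σ Γ) s) : BFormula L σ Γ
  | rel {Γ : List S} (R : L.Rel) (ts : ∀ i : L.RelArg R, Term L (ctx σ Γ) (L.rdom R i)) :
      BFormula L σ Γ
  | and {Γ : List S} (φ ψ : BFormula L σ Γ) : BFormula L σ Γ
  | or {Γ : List S} (φ ψ : BFormula L σ Γ) : BFormula L σ Γ
  | ex {Γ : List S} (s : S) (φ : BFormula L σ (s :: Γ)) : BFormula L σ Γ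

/-- Positive existential formulas `φ(x)` in the tuple of variables `x = (x)_{x ∈ X}`. -/
abbrev Formula (L : Signature S) {X : Type w} (σ : X → S) : Type (max u w) := BFormula L σ []

/-- Structures for a many-sorted signature. -/
structure Str (L : Signature S) where
  carrier : S → Type u
  func : ∀ f : L.Func, (∀ i : L.FuncArg f, carrier (L.dom f i)) → carrier (L.cod f)
  rel : ∀ R : L.Rel, (∀ i : L.RelArg R, carrier (L.rdom R i)) → Prop

namespace Str

variable {L : Signature S} (M : Str L)

/-- Tuples of elements of `M`, of the sorts prescribed by `σ`. -/
abbrev Tuple {X : Type w} (σ : X → S) : Type (max u w) := ∀ x : X, M.carrier (σ x)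

/-- Concatenation of two tuples. -/
def append {X : Type*} {Y : Type*} {σ : X → S} {τ : Y → S} (a : M.Tuple σ) (b : M.Tuple τ) :
    M.Tuple (Sum.elim σ τ)
  | Sum.inl x => a x
  | Sum.inr y => b y

/-- Value of a term. -/
def eval {X : Type w} {σ : X → S} (v : M.Tuple σ) : {s : S} → Term L σ s → M.carrier s
  | _, .var x => v x
  | _, .app f ts => M.func f fun i => eval v (ts i)

/-- Truth of a formula under an assignment of its free and bound variables. -/
def BRealize {X : Type w} {σ : X → S} (v : M.Tuple σ) :
    {Γ : List S} → BFormula L σ Γ → M.Tuple Γ.get → Prop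
  | _, .top, _ => True
  | _, .bot, _ => False
  | _, .equal t₁ t₂, xs => M.eval (M.append v xs) t₁ = M.eval (M.append v xs) t₂
  | _, .rel R ts, xs => M.rel R fun i => M.eval (M.append v xs) (ts i)
  | _, .and φ ψ, xs => BRealize v φ xs ∧ BRealize v ψ xs
  | _, .or φ ψ, xs => BRealize v φ xs ∨ BRealize v ψ xs
  | Γ, .ex s φ, xs => ∃ c : M.carrier s,
      BRealize v φ (Fin.cons (α := fun i => M.carrier ((s :: Γ).get i)) c xs)

/-- `M ⊨ φ(a)`. -/
def Realize {X : Type w} {σ : X → S} (φ : Formula L σ) (a : M.Tuple σ) : Prop :=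
  M.BRealize a φ (fun i => i.elim0)

/-- `M ⊨ Σ(a)` for a set of formulas. -/
def RealizeSet {X : Type w} {σ : X → S} (Φ : Set (Formula L σ)) (a : M.Tuple σ) : Prop :=
  ∀ φ ∈ Φ, M.Realize φ a

/-- The positive existential type `tp(a)` (over `∅`) of a tuple. -/
def tp {X : Type w} {σ : X → S} (a : M.Tuple σ) : Set (Formula L σ) := {φ | M.Realize φ a}

/-- A sort-preserving bijection of `M` is an automorphism if it preserves functions and preserves
and reflects relations. -/
def IsAutomorphism (f : ∀ s, M.carrier s ≃ M.carrier s) : Prop :=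
  (∀ (g : L.Func) (a : ∀ i, M.carrier (L.dom g i)),
      f _ (M.func g a) = M.func g fun i => f _ (a i)) ∧
  ∀ (R : L.Rel) (a : ∀ i, M.carrier (L.rdom R i)), M.rel R (fun i => f _ (a i)) ↔ M.rel R a

/-- `(a_i)_{i < ω}` is indiscernible (over `∅`): `tp(a_{i_1} … a_{i_n}) = tp(a_{j_1} … a_{j_n})`
whenever `i_1 < … < i_n` and `j_1 < … < j_n`. -/
def Indiscernible {X : Type w} {σ : X → S} (a : ℕ → M.Tuple σ) : Prop :=
  ∀ (n : ℕ) (i j : Fin n → ℕ), StrictMono i → StrictMono j →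
    M.tp (σ := fun p : Fin n × X => σ p.2) (fun p => a (i p.1) p.2) =
      M.tp (σ := fun p : Fin n × X => σ p.2) (fun p => a (j p.1) p.2)

end Str

/-- h-inductive sentences `∀ x (φ(x) → ψ(x))`, with `x` a finite tuple of variables. -/
structure HSentence (L : Signature S) where
  n : ℕ
  sorts : Fin n → S
  premise : Formula L sorts
  conclusion : Formula L sorts

/-- Truth of an h-inductive sentence. -/
def Str.Satisfies {L : Signature S} (M : Str L) (χ : HSentence L) : Prop :=
  ∀ a : M.Tuple χ.sorts, M.Realize χ.premise a → M.Realize χ.conclusion a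

/-- A (positive) theory is a set of h-inductive sentences. -/
abbrev Theory (L : Signature S) := Set (HSentence L)

/-- `M` is a model of `T`. -/
def Str.Models {L : Signature S} (M : Str L) (T : Theory L) : Prop := ∀ χ ∈ T, M.Satisfies χ

/-- The set of all h-inductive sentences true in `M`. -/
def Str.theory {L : Signature S} (M : Str L) : Theory L := {χ | M.Satisfies χ}

namespace Theory

variable {L : Signature S} (T : Theory L)

/-- Joint embedding property: for positive existential sentences, `T ⊨ ¬φ ∨ ¬ψ` implies `T ⊨ ¬φ`
or `T ⊨ ¬ψ`. -/
def JEP : Prop :=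
  ∀ φ ψ : Formula L (Empty.elim : Empty → S),
    (∀ N : Str L, N.Models T → ¬ N.Realize φ (fun x => x.elim) ∨ ¬ N.Realize ψ (fun x => x.elim)) →
    (∀ N : Str L, N.Models T → ¬ N.Realize φ (fun x => x.elim)) ∨
      ∀ N : Str L, N.Models T → ¬ N.Realize ψ (fun x => x.elim)

/-- `M` is an existentially closed model of `T`: whenever `M ⊭ φ(a)` there is `ψ(x)` with
`T ⊨ ¬∃x (φ(x) ∧ ψ(x))` and `M ⊨ ψ(a)`. -/
def IsEC (M : Str L) : Prop :=
  M.Models T ∧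
  ∀ (X : Type u) (σ : X → S) (φ : Formula L σ) (a : M.Tuple σ), ¬ M.Realize φ a →
    ∃ ψ : Formula L σ, M.Realize ψ a ∧
      ∀ N : Str L, N.Models T → ∀ b : N.Tuple σ, ¬ (N.Realize φ b ∧ N.Realize ψ b)

/-- `M` is a monster model of `T`, where "small" means of cardinality less than `κ`. -/
structure IsMonster (κ : Cardinal.{u}) (M : Str L) : Prop where
  /-- `M` is an e.c. model of `T` -/
  ec : T.IsEC M
  /-- partial immersions `a ↦ b` between small sets extend to automorphisms -/
  homogeneous : ∀ (X : Type u) (σ : X → S), #X < κ → ∀ a b : M.Tuple σ, M.tp a = M.tp b →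
    ∃ f : ∀ s, M.carrier s ≃ M.carrier s, M.IsAutomorphism f ∧ ∀ x, f _ (a x) = b x
  /-- a finitely satisfiable small set of formulas `φ(x, m)`, with parameters in `M`, is
  satisfiable -/
  saturated : ∀ (X : Type u) (σ : X → S), #X < κ →
    ∀ Φ : Set (Formula L (Sum.elim σ (Sigma.fst : (Σ s, M.carrier s) → S))), #Φ < κ →
      (∀ Φ₀ ⊆ Φ, Φ₀.Finite → ∃ a : M.Tuple σ, M.RealizeSet Φ₀ (M.append a Sigma.snd)) →
      ∃ a : M.Tuple σ, M.RealizeSet Φ (M.append a Sigma.snd)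

/-- A set of formulas is consistent with `T` if it is realised in some model of `T`. -/
def Consistent {X : Type u} {σ : X → S} (p : Set (Formula L σ)) : Prop :=
  ∃ N : Str L, N.Models T ∧ ∃ a : N.Tuple σ, N.RealizeSet p a

/-- A type in `T` is a maximal set of formulas consistent with `T`. -/
def IsType {X : Type u} {σ : X → S} (p : Set (Formula L σ)) : Prop :=
  Maximal T.Consistent p

/-- `T`, with monster model `M`, is Hausdorff: distinct types `p(x)`, `q(x)` in a small tuple of
variables admit `φ ∉ p` and `ψ ∉ q` with `M ⊨ ∀ x (φ(x) ∨ ψ(x))`. -/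
def IsHausdorff (κ : Cardinal.{u}) (M : Str L) : Prop :=
  ∀ (X : Type u) (σ : X → S), #X < κ → ∀ p q : Set (Formula L σ), T.IsType p → T.IsType q → p ≠ q →
    ∃ φ ψ : Formula L σ, φ ∉ p ∧ ψ ∉ q ∧ ∀ a : M.Tuple σ, M.Realize φ a ∨ M.Realize ψ a

/-- A partial type in `T` is a set of formulas consistent with `T`. The theory `T`, with monster
model `M`, is semi-Hausdorff: equality of types of small tuples is defined by a partial type. -/
def IsSemiHausdorff (κ : Cardinal.{u}) (M : Str L) : Prop :=
  ∀ (X : Type u) (σ : X → S), #X < κ → ∃ Ω : Set (Formula L (Sum.elim σ σ)), T.Consistent Ω ∧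
    ∀ a b : M.Tuple σ, M.tp a = M.tp b ↔ M.RealizeSet Ω (M.append a b)

/-- `T`, with monster model `M`, is thick: indiscernibility of an `ω`-sequence of small tuples is
defined by a partial type. -/
def IsThick (κ : Cardinal.{u}) (M : Str L) : Prop :=
  ∀ (X : Type u) (σ : X → S), #X < κ →
    ∃ Θ : Set (Formula L (fun p : ℕ × X => σ p.2)), T.Consistent Θ ∧
      ∀ a : ℕ → M.Tuple σ, M.Indiscernible a ↔ M.RealizeSet Θ (fun p => a p.1 p.2)

end Theory

/-! ### Hyperimaginaries -/

/-- A signature with exactly one sort. -/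
abbrev OneSorted := Signature PUnit.{u + 1}

/-- A family `𝓔` of sets of formulas `E(x, y)` (over `∅`), where `x` and `y` are tuples of variables
of the same length. -/
structure HypFamily (L : OneSorted.{u}) where
  /-- the index set of the family -/
  Idx : Type u
  /-- the index set of the tuples `x` and `y` in `E(x, y)` -/
  Len : Idx → Type u
  /-- the set of formulas `E(x, y)` -/
  E : ∀ e : Idx, Set (Formula L (fun _ : Len e ⊕ Len e => PUnit.unit))

/-- The sorts of the hyperimaginary language. -/
inductive HypSort (ι : Type u) : Type u
  | real : HypSort ι
  | hyp (e : ι) : HypSort ι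

namespace HypFamily

variable {L : OneSorted.{u}} (H : HypFamily L)

/-- The relation on tuples of elements of `M` defined by `E(x, y)`. -/
def Related (M : Str L) (e : H.Idx) (a b : H.Len e → M.carrier PUnit.unit) : Prop :=
  M.RealizeSet (H.E e) (Sum.elim a b)

/-- Every member of the family defines an equivalence relation in `M`. -/
def IsEquiv (M : Str L) : Prop := ∀ e, Equivalence (H.Related M e)

/-- The added relation symbols `R_φ(x, y_1, …, y_m)`: one for each `L`-formula
`φ(x, y_{1,r}, …, y_{m,r})`, where `x` is an `n`-tuple of real variables, `y_j` is of sort `S_{E_j}`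
and `y_{j,r}` is a tuple of real variables as long as the tuples representing elements of
`S_{E_j}`. -/
structure NewRel where
  n : ℕ
  m : ℕ
  e : Fin m → H.Idx
  φ : Formula L (fun _ : Fin n ⊕ (Σ j : Fin m, H.Len (e j)) => PUnit.unit)

/-- The hyperimaginary language `L_𝓔`. -/
def lang : Signature (HypSort H.Idx) where
  Func := L.Func
  FuncArg := L.FuncArg
  finite_funcArg := L.finite_funcArg
  dom _ _ := .real
  cod _ := .real
  Rel := L.Rel ⊕ H.NewRel
  RelArg := Sum.elim L.RelArg fun R => Fin R.n ⊕ Fin R.m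
  finite_relArg
    | .inl R => L.finite_relArg R
    | .inr R => inferInstanceAs (Finite (Fin R.n ⊕ Fin R.m))
  rdom
    | .inl _ => fun _ => .real
    | .inr R => Sum.elim (fun _ => .real) fun j => .hyp (R.e j)

variable {H} {M : Str L} (hE : H.IsEquiv M)

/-- The setoid of `E`-equivalence on tuples. -/
def setoid (e : H.Idx) : Setoid (H.Len e → M.carrier PUnit.unit) := ⟨H.Related M e, hE e⟩

/-- The universe of `M^𝓔`: the real sort is `M`, and the sort `S_E` is `M / E`. -/
def hypCarrier : HypSort H.Idx → Type u
  | .real => M.carrier PUnit.unit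
  | .hyp e => Quotient (setoid hE e)

/-- The `L_𝓔`-structure `M^𝓔`: symbols of `L` are interpreted as in `M`, and `R_φ(a, c_1, …, c_m)`
holds iff `M ⊨ φ(a, b_1, …, b_m)` for some representatives `b_j` of `c_j`. -/
def str : Str H.lang where
  carrier := hypCarrier hE
  func f a := M.func f a
  rel
    | .inl R => fun a => M.rel R a
    | .inr R => fun c => ∃ b : ∀ j : Fin R.m, H.Len (R.e j) → M.carrier PUnit.unit,
        (∀ j, (Quotient.mk (setoid hE (R.e j)) (b j) : hypCarrier hE (.hyp (R.e j)))
          = c (Sum.inr j)) ∧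
        M.Realize R.φ (Sum.elim (fun i => c (Sum.inl i)) fun z => b z.1 z.2)

/-- The hyperimaginary extension `T^𝓔`: all h-inductive `L_𝓔`-sentences true in `M^𝓔`. -/
def extension : Theory H.lang := (str hE).theory

end HypFamily

end PosLogic

/-!
An element of `M^𝓔` is the class of a real tuple. Along the class map, preimages of type-definable
sets are type-definable, because saturation turns the infinite existential quantifiers over
representatives into conjunctions of formulas; images are type-definable because the symbols `R_φ`
name the images of the sets defined by formulas `φ`. Hence `M^𝓔` is saturated, its types determine
which real types occur among the representatives of a tuple, and tuples of the same type have
representatives of the same type.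

* Hausdorff: the preimages of the sets of realizations of two distinct types are disjoint and
  type-definable. Real types can be separated, so by compactness these two sets can be, and the
  separating formulas descend through `R_φ`.
* Semi-Hausdorff: equality of types in `M^𝓔` is the image of equality of types in `M`.
* Thick: indiscernibility is tested on finite subtuples. An indiscernible sequence of finite tuples
  has, by the Erdős–Rado theorem, a real indiscernible sequence of representatives: a maximal
  satisfiable set of formulas about increasing tuples contains, for every formula, the formula
  itself or one contradicting it. So indiscernibility in `M^𝓔` is the image of indiscernibility in
  `M`.
-/

namespace PosLogic

/-! ### Substitution -/

section Substitution

variable {S : Type u} {L : Signature S} (M : Str L) {X X' Y : Type*} {σ : X → S} {σ' : X' → S}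
  {τ : Y → S} {Γ Γ' : List S} {s r : S}

/-- Simultaneous substitution of terms for the variables of a term. -/
def Term.subst (g : ∀ x, Term L σ' (σ x)) : {s : S} → Term L σ s → Term L σ' s
  | _, .var x => g x
  | _, .app f ts => .app f fun i => (ts i).subst g

theorem Str.eval_subst (g : ∀ x, Term L σ' (σ x)) (v : M.Tuple σ') (t : Term L σ s) :
    M.eval v (t.subst g) = M.eval (fun x => M.eval v (g x)) t := by
  induction t with
  | var x => rfl
  | app f ts ih => simp only [Term.subst, Str.eval, ih]

/-- Weakening of a term by a new innermost bound variable. -/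
def Term.weaken (s : S) (t : Term L (ctx σ Γ) r) : Term L (ctx σ (s :: Γ)) r :=
  t.subst fun
    | .inl x => .var (σ := ctx σ (s :: Γ)) (.inl x)
    | .inr k => .var (σ := ctx σ (s :: Γ)) (.inr k.succ)

theorem Str.eval_weaken (t : Term L (ctx σ Γ) r) (v : M.Tuple σ) (xs : M.Tuple Γ.get)
    (c : M.carrier s) :
    M.eval (M.append v (Fin.cons (α := fun i => M.carrier ((s :: Γ).get i)) c xs)) (t.weaken s)
      = M.eval (M.append v xs) t := by
  rw [Term.weaken, Str.eval_subst]
  congr 1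
  funext x
  rcases x with x | x <;> rfl

/-- A term without bound variables, regarded in the context `Γ`. -/
def Term.inCtx (t : Term L σ s) : Term L (ctx σ Γ) s :=
  t.subst (σ' := ctx σ Γ) fun x => .var (σ := ctx σ Γ) (.inl x)

theorem Str.eval_inCtx (t : Term L σ s) (a : M.Tuple σ) (xs : M.Tuple Γ.get) :
    M.eval (M.append a xs) t.inCtx = M.eval a t :=
  M.eval_subst (σ' := ctx σ Γ) _ _ t

/-- A substitution lifted under a quantifier, fixing the new bound variable. -/
def liftSubst (s : S) (g : ∀ v, Term L (ctx σ' Γ') (ctx σ Γ v)) :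
    ∀ v, Term L (ctx σ' (s :: Γ')) (ctx σ (s :: Γ) v)
  | .inl x => (g (.inl x)).weaken s
  | .inr ⟨0, _⟩ => .var (σ := ctx σ' (s :: Γ')) (.inr 0)
  | .inr ⟨k + 1, h⟩ => (g (.inr ⟨k, Nat.lt_of_succ_lt_succ h⟩)).weaken s

/-- Simultaneous substitution of terms for the free and bound variables of a formula. -/
def BFormula.subst : {Γ Γ' : List S} → (∀ v, Term L (ctx σ' Γ') (ctx σ Γ v)) → BFormula L σ Γ →
    BFormula L σ' Γ'
  | _, _, _, .top => .top
  | _, _, _, .bot => .bot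
  | _, _, g, .equal t₁ t₂ => .equal (t₁.subst g) (t₂.subst g)
  | _, _, g, .rel R ts => .rel R fun i => (ts i).subst g
  | _, _, g, .and φ ψ => .and (φ.subst g) (ψ.subst g)
  | _, _, g, .or φ ψ => .or (φ.subst g) (ψ.subst g)
  | _, _, g, .ex s φ => .ex s (φ.subst (liftSubst s g))

theorem Str.bRealize_subst (g : ∀ v, Term L (ctx σ' Γ') (ctx σ Γ v)) (φ : BFormula L σ Γ)
    (a : M.Tuple σ) (a' : M.Tuple σ') (xs : M.Tuple Γ.get) (xs' : M.Tuple Γ'.get)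
    (h : ∀ v, M.eval (M.append a' xs') (g v) = M.append a xs v) :
    M.BRealize a' (φ.subst g) xs' ↔ M.BRealize a φ xs := by
  induction φ generalizing Γ' with
  | top => rfl
  | bot => rfl
  | equal t₁ t₂ => simp only [BFormula.subst, Str.BRealize, Str.eval_subst, funext h]
  | rel R ts => simp only [BFormula.subst, Str.BRealize, Str.eval_subst, funext h]
  | and φ ψ ih₁ ih₂ =>
    simp only [BFormula.subst, Str.BRealize, ih₁ g xs xs' h, ih₂ g xs xs' h]
  | or φ ψ ih₁ ih₂ =>
    simp only [BFormula.subst, Str.BRealize, ih₁ g xs xs' h, ih₂ g xs xs' h]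
  | ex s φ ih =>
    simp only [BFormula.subst, Str.BRealize]
    refine exists_congr fun c => ih _ _ _ ?_
    rintro (x | ⟨_ | k, hk⟩)
    · exact (M.eval_weaken _ _ _ _).trans (h _)
    · rfl
    · exact (M.eval_weaken _ _ _ _).trans (h (.inr ⟨k, Nat.lt_of_succ_lt_succ hk⟩))

/-- Substitution, for the variables of a formula, of terms that may contain bound variables. -/
def Formula.substCtx (g : ∀ x, Term L (ctx σ' Γ') (σ x)) (φ : Formula L σ) : BFormula L σ' Γ' :=
  BFormula.subst (Γ := [])
    (fun
      | .inl x => g x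
      | .inr k => k.elim0) φ

theorem Str.bRealize_substCtx (g : ∀ x, Term L (ctx σ' Γ') (σ x)) (φ : Formula L σ)
    (a' : M.Tuple σ') (xs' : M.Tuple Γ'.get) :
    M.BRealize a' (φ.substCtx g) xs' ↔
      M.Realize φ (fun x => M.eval (M.append a' xs') (g x)) := by
  apply M.bRealize_subst
  rintro (x | k)
  · rfl
  · exact k.elim0

/-- Substitution of terms for the variables of a formula. -/
def Formula.subst (g : ∀ x, Term L σ' (σ x)) (φ : Formula L σ) : Formula L σ' :=
  φ.substCtx fun x => (g x).inCtx

theorem Str.realize_subst (g : ∀ x, Term L σ' (σ x)) (φ : Formula L σ) (a : M.Tuple σ') :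
    M.Realize (Formula.subst g φ) a ↔ M.Realize φ (fun x => M.eval a (g x)) := by
  rw [Formula.subst, Str.Realize, Str.bRealize_substCtx]
  simp only [Str.eval_inCtx]

/-- Renaming of the variables of a formula. -/
def Formula.rename (f : X → X') (φ : Formula L (fun x => σ' (f x))) : Formula L σ' :=
  Formula.subst (fun x => .var (f x)) φ

theorem Str.realize_rename (f : X → X') (φ : Formula L (fun x => σ' (f x))) (a : M.Tuple σ') :
    M.Realize (Formula.rename f φ) a ↔ M.Realize φ (fun x => a (f x)) :=
  M.realize_subst _ _ _

theorem Formula.exists_realize_iff_realizeSet {Φ : Set (Formula L σ)} (hΦ : Φ.Finite) :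
    ∃ φ : Formula L σ, ∀ (M : Str L) (a : M.Tuple σ), M.Realize φ a ↔ M.RealizeSet Φ a := by
  induction Φ, hΦ using Set.Finite.induction_on with
  | empty => exact ⟨.top, fun _ _ => iff_of_true trivial fun _ h => h.elim⟩
  | @insert φ _ _ _ ih =>
    obtain ⟨ψ, hψ⟩ := ih
    refine ⟨.and φ ψ, fun M a => ?_⟩
    rw [Str.RealizeSet, Set.forall_mem_insert]
    exact and_congr_right' (hψ M a)

theorem Formula.exists_realize_iff_exists_mem {Φ : Set (Formula L σ)} (hΦ : Φ.Finite) :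
    ∃ φ : Formula L σ, ∀ (M : Str L) (a : M.Tuple σ),
      M.Realize φ a ↔ ∃ ψ ∈ Φ, M.Realize ψ a := by
  induction Φ, hΦ using Set.Finite.induction_on with
  | empty => exact ⟨.bot, fun _ _ => iff_of_false id fun ⟨_, h, _⟩ => h⟩
  | @insert φ _ _ _ ih =>
    obtain ⟨ψ, hψ⟩ := ih
    refine ⟨.or φ ψ, fun M a => ?_⟩
    rw [Set.exists_mem_insert]
    exact or_congr_right (hψ M a)

end Substitution

/-! ### Free variables -/

section FreeVariables

variable {S : Type u} {L : Signature S} {X Y : Type*} {σ : X → S} {τ : Y → S} {Γ : List S} {s : S}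

/-- The set of variables occurring in a term. -/
def Term.vars : {s : S} → Term L σ s → Set X
  | _, .var x => {x}
  | _, .app _ ts => ⋃ i, (ts i).vars

theorem Term.finite_vars (t : Term L σ s) : t.vars.Finite := by
  induction t with
  | var x => exact Set.finite_singleton x
  | app f ts ih =>
    have := L.finite_funcArg f
    exact Set.finite_iUnion ih

/-- The set of free variables occurring in a formula. -/
def BFormula.freeVars : {Γ : List S} → BFormula L σ Γ → Set X
  | _, .top => ∅
  | _, .bot => ∅
  | _, .equal t₁ t₂ => Sum.inl ⁻¹' (t₁.vars ∪ t₂.vars)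
  | _, .rel _ ts => Sum.inl ⁻¹' ⋃ i, (ts i).vars
  | _, .and φ ψ => φ.freeVars ∪ ψ.freeVars
  | _, .or φ ψ => φ.freeVars ∪ ψ.freeVars
  | _, .ex _ φ => φ.freeVars

theorem BFormula.finite_freeVars (φ : BFormula L σ Γ) : φ.freeVars.Finite := by
  induction φ with
  | top | bot => exact Set.finite_empty
  | equal t₁ t₂ =>
    exact (t₁.finite_vars.union t₂.finite_vars).preimage Sum.inl_injective.injOn
  | rel R ts =>
    have := L.finite_relArg R
    exact (Set.finite_iUnion fun i => (ts i).finite_vars).preimage Sum.inl_injective.injOn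
  | and φ ψ ih₁ ih₂ | or φ ψ ih₁ ih₂ => exact ih₁.union ih₂
  | ex _ _ ih => exact ih

theorem Term.exists_eval_comp (t : Term L (ctx σ Γ) s) (f : Y → X)
    (hf : Sum.inl ⁻¹' t.vars ⊆ Set.range f) :
    ∃ t' : Term L (ctx (fun y => σ (f y)) Γ) s, ∀ (M : Str L) (a : M.Tuple σ)
      (xs : M.Tuple Γ.get),
      M.eval (M.append (fun y => a (f y)) xs) t' = M.eval (M.append a xs) t := by
  induction t with
  | var x =>
    rcases x with x | k
    · obtain ⟨y, rfl⟩ := hf rfl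
      exact ⟨.var (σ := ctx (fun y => σ (f y)) Γ) (.inl y), fun _ _ _ => rfl⟩
    · exact ⟨.var (σ := ctx (fun y => σ (f y)) Γ) (.inr k), fun _ _ _ => rfl⟩
  | app F ts ih =>
    choose t' ht' using fun i =>
      ih i ((Set.preimage_mono (Set.subset_iUnion (fun i => (ts i).vars) i)).trans hf)
    exact ⟨.app F t', fun M a xs => by simp only [Str.eval, ht']⟩

theorem BFormula.exists_bRealize_comp (φ : BFormula L σ Γ) (f : Y → X)
    (hf : φ.freeVars ⊆ Set.range f) :
    ∃ φ' : BFormula L (fun y => σ (f y)) Γ, ∀ (M : Str L) (a : M.Tuple σ) (xs : M.Tuple Γ.get),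
      M.BRealize (fun y => a (f y)) φ' xs ↔ M.BRealize a φ xs := by
  induction φ with
  | top => exact ⟨.top, fun _ _ _ => Iff.rfl⟩
  | bot => exact ⟨.bot, fun _ _ _ => Iff.rfl⟩
  | equal t₁ t₂ =>
    obtain ⟨t₁', h₁⟩ := t₁.exists_eval_comp f (Set.subset_union_left.trans hf)
    obtain ⟨t₂', h₂⟩ := t₂.exists_eval_comp f (Set.subset_union_right.trans hf)
    exact ⟨.equal t₁' t₂', fun M a xs => by simp only [Str.BRealize, h₁, h₂]⟩
  | rel R ts =>
    choose t' h using fun i => (ts i).exists_eval_comp f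
      ((Set.preimage_mono (Set.subset_iUnion (fun i => (ts i).vars) i)).trans hf)
    exact ⟨.rel R t', fun M a xs => by simp only [Str.BRealize, h]⟩
  | and φ ψ ih₁ ih₂ =>
    obtain ⟨φ', h₁⟩ := ih₁ (Set.subset_union_left.trans hf)
    obtain ⟨ψ', h₂⟩ := ih₂ (Set.subset_union_right.trans hf)
    exact ⟨.and φ' ψ', fun M a xs => by simp only [Str.BRealize, h₁, h₂]⟩
  | or φ ψ ih₁ ih₂ =>
    obtain ⟨φ', h₁⟩ := ih₁ (Set.subset_union_left.trans hf)
    obtain ⟨ψ', h₂⟩ := ih₂ (Set.subset_union_right.trans hf)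
    exact ⟨.or φ' ψ', fun M a xs => by simp only [Str.BRealize, h₁, h₂]⟩
  | ex s φ ih =>
    obtain ⟨φ', h⟩ := ih hf
    exact ⟨.ex s φ', fun M a xs => by simp only [Str.BRealize, h]⟩

theorem Formula.exists_realize_comp (φ : Formula L σ) (f : Y → X)
    (hf : φ.freeVars ⊆ Set.range f) :
    ∃ φ' : Formula L (fun y => σ (f y)), ∀ (M : Str L) (a : M.Tuple σ),
      M.Realize φ' (fun y => a (f y)) ↔ M.Realize φ a := by
  obtain ⟨φ', h⟩ := φ.exists_bRealize_comp f hf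
  exact ⟨φ', fun M a => h M a _⟩

end FreeVariables

/-! ### Existential quantification over tuples -/

section Exists

variable {S : Type u} {L : Signature S} {X Y : Type*} {σ : X → S} {τ : Y → S}

/-- Existential quantification over all bound variables. -/
def BFormula.exAll : (Γ : List S) → BFormula L σ Γ → Formula L σ
  | [], φ => φ
  | s :: Γ, φ => exAll Γ (.ex s φ)

theorem Str.realize_exAll (M : Str L) (Γ : List S) (φ : BFormula L σ Γ) (a : M.Tuple σ) :
    M.Realize (φ.exAll Γ) a ↔ ∃ xs : M.Tuple Γ.get, M.BRealize a φ xs := by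
  induction Γ with
  | nil =>
    refine ⟨fun h => ⟨_, h⟩, fun ⟨xs, h⟩ => ?_⟩
    rwa [show xs = fun i => i.elim0 from funext fun i => i.elim0] at h
  | cons s Γ ih =>
    rw [BFormula.exAll, ih]
    constructor
    · rintro ⟨xs, c, h⟩
      exact ⟨_, h⟩
    · rintro ⟨xs, h⟩
      refine ⟨fun i => xs i.succ, xs 0, ?_⟩
      convert h
      funext i
      rcases i with ⟨_ | k, hk⟩ <;> rfl

theorem Formula.exists_realize_iff_exists_fin {n : ℕ} {τ : Fin n → S}
    (φ : Formula L (Sum.elim σ τ)) :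
    ∃ ψ : Formula L σ, ∀ (M : Str L) (a : M.Tuple σ),
      M.Realize ψ a ↔ ∃ b : M.Tuple τ, M.Realize φ (M.append a b) := by
  obtain ⟨Γ, hΓ⟩ := List.equivSigmaTuple.surjective (⟨n, τ⟩ : Σ n, Fin n → S)
  cases hΓ
  refine ⟨BFormula.exAll Γ (φ.substCtx fun z => .var (σ := ctx σ Γ) z), fun M a => ?_⟩
  simp only [Str.realize_exAll, Str.bRealize_substCtx]
  rfl

theorem exists_extend_of_injective {A : Type*} {B : Type*} {C : B → Type*} [∀ b, Nonempty (C b)]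
    {f : A → B} (hf : f.Injective) (g : ∀ a, C (f a)) : ∃ h : ∀ b, C b, ∀ a, h (f a) = g a := by
  have : ∀ b, ∃ c : C b, ∀ a (hab : f a = b), hab ▸ g a = c := by
    intro b
    by_cases hb : ∃ a, f a = b
    · obtain ⟨a, rfl⟩ := hb
      refine ⟨g a, fun a' h => ?_⟩
      obtain rfl := hf h
      rfl
    · exact ⟨Classical.arbitrary _, fun a hab => (hb ⟨a, hab⟩).elim⟩
  choose h hh using this
  exact ⟨h, fun a => (hh _ a rfl).symm⟩

theorem Formula.exists_realize_append_comp {Z : Type*} (φ : Formula L (Sum.elim σ τ)) (e : Z → Y)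
    (he : Sum.inr ⁻¹' φ.freeVars ⊆ Set.range e) :
    ∃ φ' : Formula L (Sum.elim σ fun z => τ (e z)), ∀ (M : Str L) (a : M.Tuple σ) (b : M.Tuple τ),
      M.Realize φ' (M.append a fun z => b (e z)) ↔ M.Realize φ (M.append a b) := by
  obtain ⟨φ', hφ'⟩ := φ.exists_realize_comp (Sum.map id e) <| by
    rintro (x | y) h
    · exact ⟨.inl x, rfl⟩
    · obtain ⟨z, rfl⟩ := he h
      exact ⟨.inr z, rfl⟩
  refine ⟨φ'.subst fun
    | .inl x => .var (σ := Sum.elim σ fun z => τ (e z)) (.inl x)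
    | .inr z => .var (σ := Sum.elim σ fun z => τ (e z)) (.inr z), fun M a b => ?_⟩
  rw [Str.realize_subst, ← hφ' M (M.append a b)]
  congr! 2 with z
  rcases z with _ | _ <;> rfl

theorem Formula.exists_realize_iff_exists (φ : Formula L (Sum.elim σ τ)) :
    ∃ ψ : Formula L σ, ∀ (M : Str L) [∀ y, Nonempty (M.carrier (τ y))] (a : M.Tuple σ),
      M.Realize ψ a ↔ ∃ b : M.Tuple τ, M.Realize φ (M.append a b) := by
  have hY : (Sum.inr ⁻¹' φ.freeVars : Set Y).Finite :=
    φ.finite_freeVars.preimage Sum.inr_injective.injOn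
  obtain ⟨n, e, he, hrange⟩ := hY.fin_param
  obtain ⟨φ', hφ'⟩ := φ.exists_realize_append_comp e hrange.ge
  obtain ⟨ψ, hψ⟩ := φ'.exists_realize_iff_exists_fin
  refine ⟨ψ, fun M _ a => (hψ M a).trans ⟨?_, fun ⟨b, hb⟩ => ⟨_, (hφ' M a b).2 hb⟩⟩⟩
  rintro ⟨c, hc⟩
  obtain ⟨b, hb⟩ := exists_extend_of_injective (C := fun y => M.carrier (τ y)) he c
  obtain rfl : (fun i => b (e i)) = c := funext hb
  exact ⟨b, (hφ' M a b).1 hc⟩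

end Exists

/-! ### Counting formulas -/

section Counting

variable {S : Type u} {L : Signature S} {X V : Type u}

/-- Labels of the nodes of the syntax tree of a formula: variables, function symbols, relation
symbols, quantifiers, logical constants and binary symbols (equality and connectives). -/
abbrev NodeLabel (L : Signature S) (X : Type u) : Type u :=
  (X ⊕ ℕ) ⊕ L.Func ⊕ L.Rel ⊕ S ⊕ Bool ⊕ Fin 3

/-- The children of a node of a syntax tree. -/
abbrev NodeArity (L : Signature S) (X : Type u) : NodeLabel L X → Type
  | .inl _ => Empty
  | .inr (.inl f) => L.FuncArg f
  | .inr (.inr (.inl R)) => L.RelArg R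
  | .inr (.inr (.inr (.inl _))) => Unit
  | .inr (.inr (.inr (.inr (.inl _)))) => Empty
  | .inr (.inr (.inr (.inr (.inr _)))) => Bool

instance finite_nodeArity (k : NodeLabel L X) : Finite (NodeArity L X k) := by
  rcases k with _ | f | R | _ | _ | _
  · exact inferInstanceAs (Finite Empty)
  · exact L.finite_funcArg f
  · exact L.finite_relArg R
  · exact inferInstanceAs (Finite Unit)
  · exact inferInstanceAs (Finite Empty)
  · exact inferInstanceAs (Finite Bool)

/-- The syntax tree of a term, the variable `v` being recorded as `ι v`. -/
def Term.tree {σ : V → S} (ι : V → X ⊕ ℕ) : {s : S} → Term L σ s → WType (NodeArity L X)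
  | _, .var x => ⟨.inl (ι x), fun i => i.elim⟩
  | _, .app f ts => ⟨.inr (.inl f), fun i => (ts i).tree ι⟩

theorem Term.sigma_eq_of_tree_eq {σ : V → S} {ι : V → X ⊕ ℕ} (hι : ι.Injective) {s s' : S}
    (t : Term L σ s) (t' : Term L σ s') (h : t.tree ι = t'.tree ι) :
    (⟨s, t⟩ : Σ s, Term L σ s) = ⟨s', t'⟩ := by
  induction t generalizing s' with
  | var x =>
    cases t' with
    | var y => rw [hι (Sum.inl.inj (WType.mk.inj h).1)]
    | app f ts => exact nomatch (WType.mk.inj h).1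
  | app f ts ih =>
    cases t' with
    | var y => exact nomatch (WType.mk.inj h).1
    | app f' ts' =>
      obtain ⟨hf, hts⟩ := WType.mk.inj h
      obtain rfl := Sum.inl.inj (Sum.inr.inj hf)
      obtain rfl : ts = ts' := funext fun i =>
        sigma_mk_injective (ih i (ts' i) (congrFun (eq_of_heq hts) i))
      rfl

/-- The syntax tree of a formula. Bound variables are recorded as their de Bruijn indices. -/
def BFormula.tree {σ : X → S} : {Γ : List S} → BFormula L σ Γ → WType (NodeArity L X)
  | _, .top => ⟨.inr (.inr (.inr (.inr (.inl true)))), fun i => i.elim⟩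
  | _, .bot => ⟨.inr (.inr (.inr (.inr (.inl false)))), fun i => i.elim⟩
  | _, .equal t₁ t₂ => ⟨.inr (.inr (.inr (.inr (.inr 0)))),
      fun i => cond i (t₁.tree (Sum.map id Fin.val)) (t₂.tree (Sum.map id Fin.val))⟩
  | _, .rel R ts => ⟨.inr (.inr (.inl R)), fun i => (ts i).tree (Sum.map id Fin.val)⟩
  | _, .and φ ψ => ⟨.inr (.inr (.inr (.inr (.inr 1)))), fun i => cond i φ.tree ψ.tree⟩
  | _, .or φ ψ => ⟨.inr (.inr (.inr (.inr (.inr 2)))), fun i => cond i φ.tree ψ.tree⟩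
  | _, .ex s φ => ⟨.inr (.inr (.inr (.inl s))), fun _ => φ.tree⟩

theorem BFormula.tree_injective {σ : X → S} {Γ : List S} :
    (BFormula.tree : BFormula L σ Γ → WType (NodeArity L X)).Injective := by
  have term_inj (Γ : List S) {s s' : S} := Term.sigma_eq_of_tree_eq (L := L) (σ := ctx σ Γ)
    (Function.injective_id.sumMap Fin.val_injective) (s := s) (s' := s')
  intro φ ψ h
  induction φ with
  | top | bot => cases ψ <;> first | rfl | exact nomatch (WType.mk.inj h).1
  | equal t₁ t₂ =>
    cases ψ with
    | equal t₁' t₂' =>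
      have hts := eq_of_heq (WType.mk.inj h).2
      obtain ⟨rfl, ht₁⟩ := Sigma.mk.inj (term_inj _ t₁ t₁' (congrFun hts true))
      rw [eq_of_heq ht₁, sigma_mk_injective (term_inj _ t₂ t₂' (congrFun hts false))]
    | _ => exact nomatch (WType.mk.inj h).1
  | rel R ts =>
    cases ψ with
    | rel R' ts' =>
      obtain ⟨hR, hts⟩ := WType.mk.inj h
      obtain rfl := Sum.inl.inj (Sum.inr.inj (Sum.inr.inj hR))
      obtain rfl : ts = ts' := funext fun i =>
        sigma_mk_injective (term_inj _ _ _ (congrFun (eq_of_heq hts) i))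
      rfl
    | _ => exact nomatch (WType.mk.inj h).1
  | and φ₁ φ₂ ih₁ ih₂ =>
    cases ψ with
    | and ψ₁ ψ₂ =>
      have hφ := eq_of_heq (WType.mk.inj h).2
      rw [ih₁ (congrFun hφ true), ih₂ (congrFun hφ false)]
    | _ => exact nomatch (WType.mk.inj h).1
  | or φ₁ φ₂ ih₁ ih₂ =>
    cases ψ with
    | or ψ₁ ψ₂ =>
      have hφ := eq_of_heq (WType.mk.inj h).2
      rw [ih₁ (congrFun hφ true), ih₂ (congrFun hφ false)]
    | _ => exact nomatch (WType.mk.inj h).1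
  | ex s φ ih =>
    cases ψ with
    | ex s' φ' =>
      obtain ⟨hs, hφ⟩ := WType.mk.inj h
      obtain rfl := Sum.inl.inj (Sum.inr.inj (Sum.inr.inj (Sum.inr.inj hs)))
      rw [ih (congrFun (eq_of_heq hφ) ())]
    | _ => exact nomatch (WType.mk.inj h).1

theorem mk_formula_le (σ : X → S) {ν : Cardinal.{u}} (hν : ℵ₀ ≤ ν) (hX : #X ≤ ν)
    (hF : #L.Func ≤ ν) (hR : #L.Rel ≤ ν) (hS : #S ≤ ν) : #(Formula L σ) ≤ ν := by
  refine (mk_le_of_injective BFormula.tree_injective).trans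
    (WType.cardinalMk_le_max_aleph0_of_finite'.trans (max_le ?_ hν))
  have countable_le (A : Type) [Countable A] : lift.{u} #A ≤ ν :=
    (lift_le_aleph0.2 mk_le_aleph0).trans hν
  simp only [NodeLabel, mk_sum, lift_add, lift_id, lift_uzero]
  exact add_le_of_le hν (add_le_of_le hν hX (countable_le ℕ)) <| add_le_of_le hν hF <|
    add_le_of_le hν hR <| add_le_of_le hν hS <|
      add_le_of_le hν (countable_le Bool) (countable_le (Fin 3))

end Counting

/-! ### The Erdős–Rado theorem -/

section ErdosRado

variable {I : Type u} [LinearOrder I] [WellFoundedLT I] {C : Type u} {n : ℕ}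
  {Θ : Type u} [LinearOrder Θ] [WellFoundedLT Θ]

/-- Candidates for the `i`-th point of the branch below `x` of the Erdős–Rado tree of the colouring
`f`, given its earlier points `b j`, `j < i`: the later points that `f` does not distinguish from
`x` over the earlier ones. -/
def branchSet (f : (Fin n → I) → I → C) (x : I) (i : Θ) (b : ∀ j, j < i → I) : Set I :=
  {y | (∀ j hj, b j hj < y) ∧ ∀ (s : Fin n → Θ) (hs : ∀ k, s k < i),
    f (fun k => b (s k) (hs k)) y = f (fun k => b (s k) (hs k)) x}

/-- The branch below `x` of the Erdős–Rado tree of `f`. It is constant once it reaches `x`. -/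
noncomputable def branch (f : (Fin n → I) → I → C) (x : I) : Θ → I :=
  wellFounded_lt.fix fun i b =>
    wellFounded_lt.min (insert x (branchSet f x i b)) (Set.insert_nonempty _ _)

variable (f : (Fin n → I) → I → C)

theorem branch_eq (x : I) (i : Θ) :
    branch f x i = wellFounded_lt.min (insert x (branchSet f x i fun j _ => branch f x j))
      (Set.insert_nonempty _ _) :=
  wellFounded_lt.fix_eq _ _

theorem branch_mem_branchSet {x : I} {i : Θ} (h : branch f x i ≠ x) :
    branch f x i ∈ branchSet f x i fun j _ => branch f x j := by
  have hmin := wellFounded_lt.min_mem (insert x (branchSet f x i fun j _ => branch f x j))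
    (Set.insert_nonempty _ _)
  rw [← branch_eq] at hmin
  exact hmin.resolve_left h

theorem branch_le (x : I) (i : Θ) : branch f x i ≤ x := by
  rw [branch_eq]
  exact not_lt.1 (wellFounded_lt.not_lt_min _ (Set.mem_insert _ _))

theorem insert_branchSet_branch {x : I} {i : Θ} (h : ∀ j < i, branch f x j ≠ x) :
    insert x (branchSet f x i fun j _ => branch f x j) =
      branchSet f x i fun j _ => branch f x j :=
  Set.insert_eq_of_mem ⟨fun j hj => (branch_le f x j).lt_of_ne (h j hj), fun _ _ => rfl⟩

theorem branch_eq_of_agree {x x' : I} {i : Θ} (h : ∀ j < i, branch f x j ≠ x)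
    (h' : ∀ j < i, branch f x' j ≠ x')
    (hf : ∀ s : Fin n → Θ, f (fun k => branch f x (s k)) x = f (fun k => branch f x' (s k)) x')
    {j : Θ} (hj : j ≤ i) : branch f x j = branch f x' j := by
  induction j using WellFoundedLT.induction with
  | ind j ih =>
    have hlt : ∀ l < j, branch f x l = branch f x' l := fun l hl => ih l hl (hl.le.trans hj)
    have hset : (branchSet f x j fun l _ => branch f x l) =
        branchSet f x' j fun l _ => branch f x' l := by
      ext y
      refine and_congr (forall₂_congr fun l hl => by simp only [hlt l hl])
        (forall₂_congr fun s hs => ?_)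
      rw [hf s, show (fun k => branch f x (s k)) = fun k => branch f x' (s k) from
        funext fun k => hlt _ (hs k)]
    rw [branch_eq, branch_eq]
    congr 1
    rw [insert_branchSet_branch f fun l hl => h l (hl.trans_le hj),
      insert_branchSet_branch f fun l hl => h' l (hl.trans_le hj), hset]

-- If every `x` lay on its own branch, `x` would be determined by its height and the colours of
-- the tuples below it.
theorem exists_endHomogeneous (hI : #(Θ × ((Fin n → Θ) → C)) < #I) :
    ∃ (x : I) (b : Θ → I), StrictMono b ∧
      ∀ (s : Fin n → Θ) (i : Θ), (∀ k, s k < i) →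
        f (fun k => b (s k)) (b i) = f (fun k => b (s k)) x := by
  by_contra hcon
  have hreach : ∀ x : I, ∃ i : Θ, branch f x i = x := by
    by_contra! ⟨x, hx⟩
    exact hcon ⟨x, branch f x, fun j i hji => (branch_mem_branchSet f (hx i)).1 j hji,
      fun s i hs => (branch_mem_branchSet f (hx i)).2 s hs⟩
  let height : I → Θ := fun x => wellFounded_lt.min {i : Θ | branch f x i = x} (hreach x)
  have branch_height : ∀ x, branch f x (height x) = x := fun x =>
    wellFounded_lt.min_mem {i : Θ | branch f x i = x} (hreach x)
  have branch_ne : ∀ x, ∀ j < height x, branch f x j ≠ x := fun x j hj he =>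
    wellFounded_lt.not_lt_min {i : Θ | branch f x i = x} he hj
  refine hI.not_ge (mk_le_of_injective
    (f := fun x => (height x, fun s : Fin n → Θ => f (fun k => branch f x (s k)) x)) ?_)
  intro x x' h
  obtain ⟨hheight, hcolour⟩ := Prod.mk.inj h
  have := branch_eq_of_agree f (branch_ne x) (hheight ▸ branch_ne x') (congrFun hcolour) le_rfl
  rwa [branch_height, hheight, branch_height] at this

theorem power_lt_of_isStrongLimit {a b B : Cardinal.{u}} (hB : B.IsStrongLimit) (ha : a < B)
    (hb : b < B) : a ^ b < B := by
  calc a ^ b ≤ (2 ^ a) ^ b := power_le_power_right (cantor a).le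
    _ = 2 ^ (a * b) := (power_mul ..).symm
    _ < B := hB.isStrongPrelimit (mul_lt_of_lt hB.aleph0_le ha hb)

-- Erdős–Rado, with the unspecified bound `B` in place of the iterated exponential.
theorem exists_homogeneous {B : Cardinal.{u}} (hB : B.IsStrongLimit) (hC : #C < B) (Θ : Type u)
    [LinearOrder Θ] [WellFoundedLT Θ] (hΘ : #Θ < B) (n : ℕ) :
    ∃ (I : Type u) (_ : LinearOrder I) (_ : WellFoundedLT I), #I < B ∧
      ∀ f : (Fin n → I) → C, ∃ (b : Θ → I) (c : C), StrictMono b ∧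
        ∀ s : Fin n → Θ, StrictMono s → f (fun k => b (s k)) = c := by
  induction n with
  | zero =>
    exact ⟨Θ, inferInstance, inferInstance, hΘ, fun f => ⟨id, f Fin.elim0, strictMono_id,
      fun s _ => congrArg f (funext fun k => k.elim0)⟩⟩
  | succ n ih =>
    obtain ⟨J, _, _, hJ, homogeneous_J⟩ := ih
    have hlt : #(J × ((Fin n → J) → C)) < B := by
      have hn : #(Fin n → J) < B := by
        simpa using power_lt_of_isStrongLimit hB hJ (natCast_lt_aleph0.trans_le hB.aleph0_le)
      rw [mk_prod, lift_id, lift_id, ← power_def]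
      exact mul_lt_of_lt hB.aleph0_le hJ (power_lt_of_isStrongLimit hB hC hn)
    obtain ⟨I, _, _, hI⟩ : ∃ (I : Type u) (_ : LinearOrder I) (_ : WellFoundedLT I),
        #I = Order.succ #(J × ((Fin n → J) → C)) :=
      ⟨(Order.succ #(J × ((Fin n → J) → C))).ord.ToType, inferInstance, inferInstance,
        mk_ord_toType _⟩
    refine ⟨I, _, ‹_›, hI ▸ hB.isSuccLimit.succ_lt hlt, fun f => ?_⟩
    obtain ⟨x, b, hb, h_end⟩ := exists_endHomogeneous (Θ := J)
      (fun s y => f (Fin.snoc (α := fun _ => I) s y)) (hI ▸ Order.lt_succ _)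
    obtain ⟨b', c, hb', hc⟩ := homogeneous_J fun s =>
      f (Fin.snoc (α := fun _ => I) (fun k => b (s k)) x)
    refine ⟨b ∘ b', c, hb.comp hb', fun s hs => ?_⟩
    calc f (fun k => b (b' (s k)))
      _ = f (Fin.snoc (α := fun _ => I) (fun k => b (b' (s k.castSucc)))
            (b (b' (s (.last n))))) := by
          congr 1
          funext k
          refine Fin.lastCases ?_ (fun k => ?_) k <;> simp
      _ = f (Fin.snoc (α := fun _ => I) (fun k => b (b' (s k.castSucc))) x) :=
          h_end _ _ fun k => hb' (hs (Fin.castSucc_lt_last k))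
      _ = c := hc _ fun k l hkl => hs (Fin.castSucc_lt_castSucc_iff.2 hkl)

end ErdosRado

/-! ### Type-definable sets -/

section TypeDefinable

variable {S : Type u} {L : Signature S} {M : Str L} {X Y : Type*} {σ : X → S} {τ : Y → S}
  {D E : Set (M.Tuple σ)}

/-- A set of tuples is type-definable (over `∅`) if it is defined by a set of formulas. -/
def Str.TypeDefinable (M : Str L) (D : Set (M.Tuple σ)) : Prop :=
  ∃ Φ : Set (Formula L σ), D = {a | M.RealizeSet Φ a}

theorem typeDefinable_realizeSet (Φ : Set (Formula L σ)) : M.TypeDefinable {a | M.RealizeSet Φ a} :=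
  ⟨Φ, rfl⟩

theorem typeDefinable_realize (φ : Formula L σ) : M.TypeDefinable {a | M.Realize φ a} :=
  ⟨{φ}, by ext a; simp [Str.RealizeSet]⟩

namespace Str.TypeDefinable

theorem iInter {ι : Sort*} {D : ι → Set (M.Tuple σ)} (hD : ∀ i, M.TypeDefinable (D i)) :
    M.TypeDefinable (⋂ i, D i) := by
  choose Φ hΦ using hD
  refine ⟨⋃ i, Φ i, ?_⟩
  ext a
  simp only [hΦ, Set.mem_iInter, Set.mem_ofPred_eq, Str.RealizeSet, Set.mem_iUnion]
  exact ⟨fun h φ ⟨i, hi⟩ => h i φ hi, fun h i φ hi => h φ ⟨i, hi⟩⟩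

theorem inter (hD : M.TypeDefinable D) (hE : M.TypeDefinable E) : M.TypeDefinable (D ∩ E) := by
  rw [Set.inter_eq_iInter]
  exact iInter fun b => by cases b <;> assumption

theorem union (hD : M.TypeDefinable D) (hE : M.TypeDefinable E) : M.TypeDefinable (D ∪ E) := by
  obtain ⟨Φ, rfl⟩ := hD
  obtain ⟨Ψ, rfl⟩ := hE
  refine ⟨Set.image2 BFormula.or Φ Ψ, ?_⟩
  ext a
  simp only [Set.mem_union, Set.mem_ofPred_eq, Str.RealizeSet, Set.forall_mem_image2]
  refine ⟨fun h φ hφ ψ hψ => h.imp (· φ hφ) (· ψ hψ), fun h => ?_⟩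
  by_contra! ⟨⟨φ, hφ, hφa⟩, ψ, hψ, hψa⟩
  exact (h φ hφ ψ hψ).elim hφa hψa

theorem subst {D : Set (M.Tuple τ)} (hD : M.TypeDefinable D) (g : ∀ y, Term L σ (τ y)) :
    M.TypeDefinable {a : M.Tuple σ | (fun y => M.eval a (g y)) ∈ D} := by
  obtain ⟨Φ, rfl⟩ := hD
  refine ⟨Formula.subst g '' Φ, ?_⟩
  ext a
  simp only [Set.mem_ofPred_eq, Str.RealizeSet, Set.forall_mem_image, Str.realize_subst]

theorem reindex {f : Y → X} {D : Set (M.Tuple fun y => σ (f y))} (hD : M.TypeDefinable D) :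
    M.TypeDefinable {a : M.Tuple σ | (fun y => a (f y)) ∈ D} :=
  hD.subst fun y => .var (f y)

theorem mem_of_tp_subset (hD : M.TypeDefinable D) {a b : M.Tuple σ} (h : M.tp a ⊆ M.tp b)
    (ha : a ∈ D) : b ∈ D := by
  obtain ⟨Φ, rfl⟩ := hD
  exact fun φ hφ => h (ha φ hφ)

end Str.TypeDefinable

theorem typeDefinable_exists_realize (φ : Formula L (Sum.elim σ τ)) :
    M.TypeDefinable {a : M.Tuple σ | ∃ b : M.Tuple τ, M.Realize φ (M.append a b)} := by
  by_cases hne : ∀ y, Nonempty (M.carrier (τ y))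
  · obtain ⟨ψ, hψ⟩ := φ.exists_realize_iff_exists
    convert typeDefinable_realize (M := M) ψ using 1
    exact Set.ext fun a => (hψ M a).symm
  · push Not at hne
    obtain ⟨y, hy⟩ := hne
    convert typeDefinable_realize (M := M) (σ := σ) .bot using 1
    exact Set.ext fun a => iff_of_false (fun ⟨b, _⟩ => hy.false (b y)) id

end TypeDefinable

/-! ### Types and indiscernible sequences -/

section Types

variable {S : Type u} {L : Signature S} {M : Str L} {X Y : Type*} {σ : X → S}

/-- The tuple `(a_i)_{i ∈ I}` selected from the tuples of a sequence by a family of indices. -/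
abbrev Str.select {I J : Type*} (a : I → M.Tuple σ) (i : J → I) :
    M.Tuple (fun p : J × X => σ p.2) :=
  fun p => a (i p.1) p.2

theorem Str.tp_comp_subset {a b : M.Tuple σ} (h : M.tp a ⊆ M.tp b) (f : Y → X) :
    M.tp (σ := fun y => σ (f y)) (fun y => a (f y)) ⊆
      M.tp (σ := fun y => σ (f y)) fun y => b (f y) :=
  fun φ hφ => (M.realize_rename f φ b).1 (h ((M.realize_rename f φ a).2 hφ))

theorem Str.tp_comp_eq {a b : M.Tuple σ} (h : M.tp a = M.tp b) (f : Y → X) :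
    M.tp (σ := fun y => σ (f y)) (fun y => a (f y)) =
      M.tp (σ := fun y => σ (f y)) fun y => b (f y) :=
  (Str.tp_comp_subset h.subset f).antisymm (Str.tp_comp_subset h.superset f)

theorem Str.Indiscernible.of_tp_eq {a b : ℕ → M.Tuple σ} (ha : M.Indiscernible a)
    (h : M.tp (σ := fun p : ℕ × X => σ p.2) (fun p => a p.1 p.2) =
      M.tp (σ := fun p : ℕ × X => σ p.2) fun p => b p.1 p.2) : M.Indiscernible b := by
  intro n i j hi hj
  have tp_select (i : Fin n → ℕ) := Str.tp_comp_eq h fun p : Fin n × X => (i p.1, p.2)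
  exact (tp_select i).symm.trans ((ha n i j hi hj).trans (tp_select j))

theorem Str.Indiscernible.comp {a : ℕ → M.Tuple σ} (ha : M.Indiscernible a) (f : Y → X) :
    M.Indiscernible (σ := fun y => σ (f y)) fun k y => a k (f y) :=
  fun n i j hi hj => Str.tp_comp_eq (σ := fun p : Fin n × X => σ p.2) (ha n i j hi hj)
    fun p : Fin n × Y => (p.1, f p.2)

theorem Str.tp_eq_of_forall_finite {a b : M.Tuple σ}
    (h : ∀ A : Set X, A.Finite → M.tp (σ := fun x : A => σ x) (fun x => a x) =
      M.tp (σ := fun x : A => σ x) fun x => b x) : M.tp a = M.tp b := by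
  ext φ
  obtain ⟨φ', hφ'⟩ := φ.exists_realize_comp ((↑) : φ.freeVars → X) Subtype.range_coe.ge
  have := Set.ext_iff.1 (h _ φ.finite_freeVars) φ'
  exact (hφ' M a).symm.trans (this.trans (hφ' M b))

theorem Str.indiscernible_of_forall_finite {a : ℕ → M.Tuple σ}
    (h : ∀ A : Set X, A.Finite → M.Indiscernible (σ := fun x : A => σ x) fun k x => a k x) :
    M.Indiscernible a := by
  refine fun n i j hi hj => Str.tp_eq_of_forall_finite fun A hA => ?_
  exact Str.tp_comp_eq (h _ (hA.image Prod.snd) n i j hi hj) fun p : A =>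
    ((p : Fin n × X).1, (⟨(p : Fin n × X).2, Set.mem_image_of_mem _ p.2⟩ : Prod.snd '' A))

theorem Str.tp_subset_of_forall_fin {a b : ℕ → M.Tuple σ}
    (h : ∀ n : ℕ, M.tp (Str.select a ((↑) : Fin n → ℕ)) ⊆ M.tp (Str.select b ((↑) : Fin n → ℕ))) :
    M.tp (σ := fun p : ℕ × X => σ p.2) (fun p => a p.1 p.2) ⊆
      M.tp (σ := fun p : ℕ × X => σ p.2) fun p => b p.1 p.2 := by
  intro φ hφ
  obtain ⟨N, hN⟩ := (φ.finite_freeVars.image Prod.fst).bddAbove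
  obtain ⟨φ', hφ'⟩ := φ.exists_realize_comp (fun p : Fin (N + 1) × X => ((p.1 : ℕ), p.2))
    fun p hp => ⟨(⟨p.1, Nat.lt_succ_of_le (hN ⟨p, hp, rfl⟩)⟩, p.2), rfl⟩
  exact (hφ' M fun p => b p.1 p.2).1 (h (N + 1) ((hφ' M fun p => a p.1 p.2).2 hφ))

end Types

section ExistentiallyClosed

variable {S : Type u} {L : Signature S} {T : Theory L} {M : Str L} {X : Type u} {σ : X → S}

theorem Theory.IsEC.tp_eq_of_subset (hM : T.IsEC M) {a b : M.Tuple σ} (h : M.tp a ⊆ M.tp b) :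
    M.tp a = M.tp b := by
  refine h.antisymm fun φ hφ => ?_
  by_contra hcon
  obtain ⟨ψ, hψ, hφψ⟩ := hM.2 X σ φ a hcon
  exact hφψ M hM.1 b ⟨hφ, h hψ⟩

theorem Theory.IsEC.isType_tp (hM : T.IsEC M) (a : M.Tuple σ) : T.IsType (M.tp a) := by
  refine ⟨⟨M, hM.1, a, fun φ hφ => hφ⟩, ?_⟩
  rintro q ⟨N, hN, b, hb⟩ hq φ hφ
  by_contra hcon
  obtain ⟨ψ, hψ, hφψ⟩ := hM.2 X σ φ a hcon
  exact hφψ N hN b ⟨hb φ hφ, hb ψ (hq hψ)⟩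

theorem Theory.IsEC.nonempty_carrier (hM : T.IsEC M) (hT : T.JEP) {N : Str L} (hN : N.Models T)
    {s : S} (c : N.carrier s) : Nonempty (M.carrier s) := by
  by_contra hcon
  obtain ⟨ψ, hψ, hφψ⟩ := hM.2 PEmpty (fun x => x.elim) (.ex s .top) (fun x => x.elim)
    fun ⟨c, _⟩ => hcon ⟨c⟩
  let ψ' : Formula L (Empty.elim : Empty → S) := Formula.subst (fun x => x.elim) ψ
  have hψ' (N : Str L) : N.Realize ψ' (fun x => x.elim) ↔ N.Realize ψ (fun x => x.elim) := by
    rw [N.realize_subst]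
    congr! with x
    exact x.elim
  obtain h | h := hT (.ex s .top) ψ' fun N hN => by
    by_contra! ⟨⟨c, _⟩, hψN⟩
    exact hφψ N hN (fun x => x.elim) ⟨⟨c, trivial⟩, (hψ' N).1 hψN⟩
  · exact h N hN ⟨c, trivial⟩
  · exact h M hM.1 ((hψ' M).2 hψ)

end ExistentiallyClosed

/-! ### Saturated structures -/

section Saturated

variable {S : Type u} {L : Signature S} {M : Str L} {κ : Cardinal.{u}} {X Y : Type u}
  {σ : X → S} {τ : Y → S}

/-- A structure is `κ`-saturated if every finitely satisfiable set of formulas in fewer than `κ`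
variables and with fewer than `κ` parameters is satisfiable. -/
def Str.IsSaturated (κ : Cardinal.{u}) (M : Str L) : Prop :=
  ∀ ⦃X Y : Type u⦄ ⦃σ : X → S⦄ ⦃τ : Y → S⦄, #X < κ → #Y < κ →
    ∀ (Φ : Set (Formula L (Sum.elim σ τ))) (a : M.Tuple σ),
      (∀ Φ₀ ⊆ Φ, Φ₀.Finite → ∃ b : M.Tuple τ, M.RealizeSet Φ₀ (M.append a b)) →
        ∃ b : M.Tuple τ, M.RealizeSet Φ (M.append a b)

theorem Theory.IsMonster.isSaturated {T : Theory L} (hM : T.IsMonster κ M) (hκ : ℵ₀ < κ)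
    (hF : #L.Func < κ) (hR : #L.Rel < κ) (hS : #S < κ) : M.IsSaturated κ := by
  intro X Y σ τ hX hY Φ a h
  let σ' : Y ⊕ (Σ s, M.carrier s) → S := Sum.elim τ Sigma.fst
  let g : ∀ z, Term L σ' (Sum.elim σ τ z)
    | .inl x => .var (σ := σ') (.inr ⟨σ x, a x⟩)
    | .inr y => .var (σ := σ') (.inl y)
  have realize_subst (φ : Formula L (Sum.elim σ τ)) (b : M.Tuple τ) :
      M.Realize (Formula.subst g φ) (M.append b Sigma.snd) ↔ M.Realize φ (M.append a b) := by
    rw [M.realize_subst]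
    congr! 1
    funext z
    cases z <;> rfl
  have hΦ : #(Formula.subst g '' Φ) < κ := by
    let ν := max (max (max (max ℵ₀ #(X ⊕ Y)) #L.Func) #L.Rel) #S
    refine mk_image_le.trans_lt ((mk_set_le _).trans_lt (lt_of_le_of_lt (b := ν) ?_ ?_))
    · apply mk_formula_le <;> simp [ν]
    · simp only [ν, max_lt_iff, mk_sum, lift_id]
      exact ⟨⟨⟨⟨hκ, add_lt_of_lt hκ.le hX hY⟩, hF⟩, hR⟩, hS⟩
  obtain ⟨b, hb⟩ := hM.saturated Y τ hY _ hΦ fun Φ₀ hΦ₀ hfin => by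
    obtain ⟨Ψ, hΨ, hΨfin, rfl⟩ := Set.exists_subset_image_finite_and.1 ⟨Φ₀, hΦ₀, hfin, rfl⟩
    obtain ⟨b, hb⟩ := h Ψ hΨ hΨfin
    exact ⟨b, Set.forall_mem_image.2 fun φ hφ => (realize_subst φ b).2 (hb φ hφ)⟩
  exact ⟨b, fun φ hφ => (realize_subst φ b).1 (hb _ (Set.mem_image_of_mem _ hφ))⟩

namespace Str.IsSaturated

theorem exists_forall_mem (hM : M.IsSaturated κ) (hX : #X < κ) (hY : #Y < κ) {ι : Type*}
    {D : ι → Set (M.Tuple (Sum.elim σ τ))} (hD : ∀ i, M.TypeDefinable (D i)) (a : M.Tuple σ)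
    (h : ∀ s : Finset ι, ∃ b : M.Tuple τ, ∀ i ∈ s, M.append a b ∈ D i) :
    ∃ b : M.Tuple τ, ∀ i, M.append a b ∈ D i := by
  choose Φ hΦ using hD
  simp only [hΦ, Set.mem_ofPred_eq] at h ⊢
  obtain ⟨b, hb⟩ := hM hX hY (⋃ i, Φ i) a fun Φ₀ hΦ₀ hfin => by
    obtain ⟨I, hI, hΦI⟩ := Set.finite_subset_iUnion hfin hΦ₀
    obtain ⟨b, hb⟩ := h hI.toFinset
    refine ⟨b, fun φ hφ => ?_⟩
    obtain ⟨i, hi, hφi⟩ := Set.mem_iUnion₂.1 (hΦI hφ)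
    exact hb i (hI.mem_toFinset.2 hi) φ hφi
  exact ⟨b, fun i φ hφ => hb φ (Set.mem_iUnion.2 ⟨i, hφ⟩)⟩

theorem exists_mem_iInter (hM : M.IsSaturated κ) (hX : #X < κ) {ι : Type*}
    {D : ι → Set (M.Tuple σ)} (hD : ∀ i, M.TypeDefinable (D i))
    (h : ∀ s : Finset ι, ∃ a, ∀ i ∈ s, a ∈ D i) : ∃ a, ∀ i, a ∈ D i :=
  hM.exists_forall_mem (σ := fun x : PEmpty => x.elim) (by simpa using pos_of_gt hX) hX
    (fun i => (hD i).reindex (f := Sum.inr)) (fun x => x.elim) h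

theorem typeDefinable_exists (hM : M.IsSaturated κ) (hX : #X < κ) (hY : #Y < κ)
    {D : Set (M.Tuple (Sum.elim σ τ))} (hD : M.TypeDefinable D) :
    M.TypeDefinable {a : M.Tuple σ | ∃ b : M.Tuple τ, M.append a b ∈ D} := by
  obtain ⟨Φ, rfl⟩ := hD
  choose conj realize_conj using fun Φ₀ : {Φ₀ // Φ₀ ⊆ Φ ∧ Φ₀.Finite} =>
    Formula.exists_realize_iff_realizeSet Φ₀.2.2
  convert Str.TypeDefinable.iInter fun Φ₀ => typeDefinable_exists_realize (M := M) (conj Φ₀)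
  ext a
  simp only [Set.mem_ofPred_eq, Set.mem_iInter, realize_conj]
  exact ⟨fun ⟨b, hb⟩ Φ₀ => ⟨b, fun φ hφ => hb φ (Φ₀.2.1 hφ)⟩,
    fun h => hM hX hY Φ a fun Φ₀ hΦ₀ hfin => h ⟨Φ₀, hΦ₀, hfin⟩⟩

theorem exists_realizeSet_of_consistent (hM : M.IsSaturated κ) (hX : #X < κ)
    {p : Set (Formula L σ)} (hp : M.theory.Consistent p) : ∃ a, M.RealizeSet p a := by
  obtain ⟨N, hN, c, hc⟩ := hp
  have nonempty_sort (x : X) : Nonempty (M.carrier (σ x)) := by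
    by_contra hempty
    exact hN ⟨1, fun _ => σ x, .top, .bot⟩ (fun a _ => hempty ⟨a 0⟩) (fun _ => c x) trivial
  obtain ⟨a, ha⟩ := hM.exists_mem_iInter hX
    (D := fun φ : p => {a | M.Realize (φ : Formula L σ) a}) (fun φ => typeDefinable_realize _)
    fun s => by
      obtain ⟨φ, hφ⟩ := Formula.exists_realize_iff_realizeSet (s.finite_toSet.image Subtype.val)
      obtain ⟨n, f, hf, hrange⟩ := φ.finite_freeVars.fin_param
      obtain ⟨φ', hφ'⟩ := φ.exists_realize_comp f hrange.ge
      have : ∃ b, M.Realize φ' b := by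
        by_contra! hcon
        refine hN ⟨n, _, φ', .bot⟩ (fun b hb => (hcon b hb).elim) _ ((hφ' N c).2 ((hφ N c).2 ?_))
        exact Set.forall_mem_image.2 fun ψ _ => hc ψ ψ.2
      obtain ⟨b, hb⟩ := this
      obtain ⟨a, ha⟩ := exists_extend_of_injective (C := fun x => M.carrier (σ x)) hf b
      obtain rfl : b = fun k => a (f k) := funext fun k => (ha k).symm
      exact ⟨a, fun ψ hψ => (hφ M a).1 ((hφ' M a).1 hb) ψ (Set.mem_image_of_mem _ hψ)⟩
  exact ⟨a, fun φ hφ => ha ⟨φ, hφ⟩⟩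

theorem exists_tp_eq (hM : M.IsSaturated κ) (hX : #X < κ) {p : Set (Formula L σ)}
    (hp : M.theory.IsType p) : ∃ a, M.tp a = p := by
  obtain ⟨a, ha⟩ := hM.exists_realizeSet_of_consistent hX hp.prop
  exact ⟨a, (hp.eq_of_subset ⟨M, fun _ hχ => hχ, a, fun _ hφ => hφ⟩ ha).symm⟩

end Str.IsSaturated

end Saturated

/-! ### Separation -/

section Separated

variable {S : Type u} {L : Signature S} {T : Theory L} {M : Str L} {κ : Cardinal.{u}} {X : Type u}
  {σ : X → S} {P Q : Set (M.Tuple σ)}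

/-- Two sets of tuples are separated if they can be enclosed in disjoint sets each of which is the
complement of a set defined by a single formula. -/
def Str.Separated (M : Str L) (P Q : Set (M.Tuple σ)) : Prop :=
  ∃ φ ψ : Formula L σ, (∀ a ∈ P, ¬M.Realize φ a) ∧ (∀ a ∈ Q, ¬M.Realize ψ a) ∧
    ∀ a, M.Realize φ a ∨ M.Realize ψ a

theorem Str.Separated.symm (h : M.Separated P Q) : M.Separated Q P := by
  obtain ⟨φ, ψ, hφ, hψ, hcover⟩ := h
  exact ⟨ψ, φ, hψ, hφ, fun a => (hcover a).symm⟩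

theorem Str.Separated.mono {P' Q' : Set (M.Tuple σ)} (h : M.Separated P Q) (hP : P' ⊆ P)
    (hQ : Q' ⊆ Q) : M.Separated P' Q' := by
  obtain ⟨φ, ψ, hφ, hψ, hcover⟩ := h
  exact ⟨φ, ψ, fun a ha => hφ a (hP ha), fun a ha => hψ a (hQ ha), hcover⟩

theorem Str.IsSaturated.separated_of_forall_left (hM : M.IsSaturated κ) (hX : #X < κ)
    (hP : M.TypeDefinable P) (h : ∀ a ∈ P, M.Separated {a} Q) : M.Separated P Q := by
  choose φ ψ hφ hψ hcover using fun a : P => h a a.2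
  obtain ⟨s, hs⟩ : ∃ s : Finset P, ∀ a ∈ P, ∃ b ∈ s, ¬M.Realize (φ b) a := by
    by_contra! hcon
    obtain ⟨a, ha⟩ := hM.exists_mem_iInter hX
      (fun b => hP.inter (typeDefinable_realize (φ b))) fun s => by
        obtain ⟨a, ha, has⟩ := hcon s
        exact ⟨a, fun b hb => ⟨ha, has b hb⟩⟩
    obtain ⟨a₀, ha₀, -⟩ := hcon ∅
    have haP : a ∈ P := (ha ⟨a₀, ha₀⟩).1
    exact hφ ⟨a, haP⟩ a rfl (ha ⟨a, haP⟩).2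
  obtain ⟨Φ, hΦ⟩ := Formula.exists_realize_iff_realizeSet (s.finite_toSet.image φ)
  obtain ⟨Ψ, hΨ⟩ := Formula.exists_realize_iff_exists_mem (s.finite_toSet.image ψ)
  refine ⟨Φ, Ψ, fun a ha hΦa => ?_, fun a ha hΨa => ?_, fun a => ?_⟩
  · obtain ⟨b, hb, hφb⟩ := hs a ha
    exact hφb ((hΦ M a).1 hΦa _ (Set.mem_image_of_mem _ hb))
  · obtain ⟨_, ⟨b, -, rfl⟩, hψb⟩ := (hΨ M a).1 hΨa
    exact hψ b a ha hψb
  · rw [hΦ, hΨ, or_iff_not_imp_right]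
    refine fun hcon => Set.forall_mem_image.2 fun b hb => (hcover b a).resolve_right fun hψb => ?_
    exact hcon ⟨_, Set.mem_image_of_mem _ hb, hψb⟩

theorem Str.IsSaturated.separated (hM : M.IsSaturated κ) (hX : #X < κ)
    (hP : M.TypeDefinable P) (hQ : M.TypeDefinable Q)
    (h : ∀ a ∈ P, ∀ b ∈ Q, M.Separated {a} {b}) : M.Separated P Q :=
  hM.separated_of_forall_left hX hP fun a ha =>
    (hM.separated_of_forall_left hX hQ fun b hb => (h a ha b hb).symm).symm

theorem Theory.IsHausdorff.separated (h : T.IsHausdorff κ M) (hM : T.IsEC M) (hX : #X < κ)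
    {a b : M.Tuple σ} (hab : M.tp a ≠ M.tp b) : M.Separated {a} {b} := by
  obtain ⟨φ, ψ, hφ, hψ, hcover⟩ := h X σ hX _ _ (hM.isType_tp a) (hM.isType_tp b) hab
  exact ⟨φ, ψ, fun _ h => h ▸ hφ, fun _ h => h ▸ hψ, hcover⟩

theorem Str.IsSaturated.isHausdorff_theory (hM : M.IsSaturated κ)
    (h : ∀ ⦃X : Type u⦄ ⦃σ : X → S⦄, #X < κ → ∀ a b : M.Tuple σ, M.tp a ≠ M.tp b →
      M.Separated {a} {b}) : M.theory.IsHausdorff κ M := by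
  intro X σ hX p q hp hq hpq
  obtain ⟨a, rfl⟩ := hM.exists_tp_eq hX hp
  obtain ⟨b, rfl⟩ := hM.exists_tp_eq hX hq
  obtain ⟨φ, ψ, hφ, hψ, hcover⟩ := h hX a b hpq
  exact ⟨φ, ψ, hφ a rfl, hψ b rfl, hcover⟩

end Separated

/-! ### Equality of types and indiscernibility as type-definable conditions -/

section Invariants

variable {S : Type u} {L : Signature S} {T : Theory L} {M : Str L} {κ : Cardinal.{u}} {X : Type u}
  {σ : X → S}

/-- The set of pairs of tuples with the same type. -/
def Str.eqTypes (M : Str L) (σ : X → S) : Set (M.Tuple (Sum.elim σ σ)) :=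
  {w | M.tp (σ := σ) (fun x => w (.inl x)) = M.tp (σ := σ) fun x => w (.inr x)}

/-- The set of indiscernible sequences of tuples. -/
def Str.indiscernibles (M : Str L) (σ : X → S) : Set (M.Tuple fun p : ℕ × X => σ p.2) :=
  {w | M.Indiscernible (σ := σ) fun k x => w (k, x)}

theorem Theory.IsSemiHausdorff.typeDefinable_eqTypes (h : T.IsSemiHausdorff κ M) (hX : #X < κ) :
    M.TypeDefinable (M.eqTypes σ) := by
  obtain ⟨Ω, -, hΩ⟩ := h X σ hX
  refine ⟨Ω, Set.ext fun w => (hΩ _ _).trans (iff_of_eq (congrArg (M.RealizeSet Ω) ?_))⟩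
  exact funext fun z => by cases z <;> rfl

theorem Theory.IsThick.typeDefinable_indiscernibles (h : T.IsThick κ M) (hX : #X < κ) :
    M.TypeDefinable (M.indiscernibles σ) := by
  obtain ⟨Θ, -, hΘ⟩ := h X σ hX
  exact ⟨Θ, Set.ext fun w => hΘ fun k x => w (k, x)⟩

theorem Theory.IsSemiHausdorff.nonempty_carrier (h : T.IsSemiHausdorff κ M) (hT : T.JEP)
    (hM : T.IsEC M) (hκ : 1 < κ) (s : S) : Nonempty (M.carrier s) := by
  obtain ⟨_, ⟨N, hN, c, -⟩, -⟩ := h PUnit (fun _ => s) (by simpa using hκ)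
  exact hM.nonempty_carrier hT hN (c (.inl ⟨⟩))

theorem Theory.IsThick.nonempty_carrier (h : T.IsThick κ M) (hT : T.JEP) (hM : T.IsEC M)
    (hκ : 1 < κ) (s : S) : Nonempty (M.carrier s) := by
  obtain ⟨_, ⟨N, hN, c, -⟩, -⟩ := h PUnit (fun _ => s) (by simpa using hκ)
  exact hM.nonempty_carrier hT hN (c (0, ⟨⟩))

theorem Str.isSemiHausdorff_theory (hne : ∀ s, Nonempty (M.carrier s))
    (h : ∀ ⦃X : Type u⦄ (σ : X → S), #X < κ → M.TypeDefinable (M.eqTypes σ)) :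
    M.theory.IsSemiHausdorff κ M := by
  intro X σ hX
  obtain ⟨Ω, hΩ⟩ := h σ hX
  have tp_eq_iff (a b : M.Tuple σ) : M.tp a = M.tp b ↔ M.RealizeSet Ω (M.append a b) :=
    Set.ext_iff.1 hΩ (M.append a b)
  have a : M.Tuple σ := fun x => (hne (σ x)).some
  exact ⟨Ω, ⟨M, fun _ hχ => hχ, _, (tp_eq_iff a a).1 rfl⟩, tp_eq_iff⟩

theorem Str.isThick_theory (hne : ∀ s, Nonempty (M.carrier s))
    (h : ∀ ⦃X : Type u⦄ (σ : X → S), #X < κ → M.TypeDefinable (M.indiscernibles σ)) :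
    M.theory.IsThick κ M := by
  intro X σ hX
  obtain ⟨Θ, hΘ⟩ := h σ hX
  have indiscernible_iff (a : ℕ → M.Tuple σ) :
      M.Indiscernible a ↔ M.RealizeSet Θ fun p => a p.1 p.2 :=
    Set.ext_iff.1 hΘ fun p => a p.1 p.2
  have a : M.Tuple σ := fun x => (hne (σ x)).some
  exact ⟨Θ, ⟨M, fun _ hχ => hχ, _, (indiscernible_iff fun _ => a).1 fun _ _ _ _ _ => rfl⟩,
    indiscernible_iff⟩

end Invariants

/-! ### Extracting indiscernible sequences -/

section Extraction

variable {S : Type u} {L : Signature S} {T : Theory L} {M : Str L} {κ B : Cardinal.{u}} {X : Type u}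
  {σ : X → S}

/-- A set of formulas `φ(x_1, …, x_n)`, for varying `n`, to be imposed on the increasing tuples of
a sequence. -/
abbrev Pattern (L : Signature S) (σ : X → S) : Type u :=
  Set (Σ n : ℕ, Formula L fun p : Fin n × X => σ p.2)

namespace Pattern

variable {Γ : Pattern L σ} {I J : Type*}

/-- All increasing tuples of the sequence `a` satisfy the pattern `Γ`. -/
def SatisfiedBy [Preorder I] (Γ : Pattern L σ) (a : I → M.Tuple σ) : Prop :=
  ∀ γ ∈ Γ, ∀ i : Fin γ.1 → I, StrictMono i → M.Realize γ.2 (Str.select a i)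

theorem SatisfiedBy.comp [Preorder I] [Preorder J] {a : I → M.Tuple σ} (h : Γ.SatisfiedBy a)
    {f : J → I} (hf : StrictMono f) : Γ.SatisfiedBy (a ∘ f) :=
  fun γ hγ i hi => h γ hγ (f ∘ i) (hf.comp hi)

/-- The pattern `Γ` is satisfied by some `ω`-sequence of tuples of `M`. -/
def Satisfiable (M : Str L) (Γ : Pattern L σ) : Prop :=
  ∃ a : ℕ → M.Tuple σ, Γ.SatisfiedBy a

theorem exists_satisfiedBy (hM : M.IsSaturated κ) (hκ : ℵ₀ ≤ κ) (hX : #X < κ) {I : Type u}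
    [Preorder I] (hI : #I < κ)
    (h : ∀ Γ₀ ⊆ Γ, Γ₀.Finite → ∀ F : Finset I, ∃ a : I → M.Tuple σ, ∀ γ ∈ Γ₀,
      ∀ i : Fin γ.1 → I, StrictMono i → (∀ k, i k ∈ F) → M.Realize γ.2 (Str.select a i)) :
    ∃ a : I → M.Tuple σ, Γ.SatisfiedBy a := by
  classical
  have hIX : #(I × X) < κ := by
    rw [mk_prod, lift_id, lift_id]
    exact mul_lt_of_lt hκ hI hX
  obtain ⟨c, hc⟩ := hM.exists_mem_iInter hIX (σ := fun p : I × X => σ p.2)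
    (D := fun t : Σ γ : Γ, {i : Fin γ.1.1 → I // StrictMono i} =>
      {c | M.Realize t.1.1.2 fun p => c (t.2.1 p.1, p.2)})
    (fun t => (typeDefinable_realize t.1.1.2).reindex (σ := fun p : I × X => σ p.2)
      (f := Prod.map t.2.1 id)) fun s => by
      obtain ⟨a, ha⟩ := h (s.image fun t => t.1.1)
        (by simp only [Finset.coe_image, Set.image_subset_iff]; exact fun t _ => t.1.2)
        (Finset.finite_toSet _) (s.biUnion fun t => Finset.univ.image t.2.1)
      exact ⟨fun p => a p.1 p.2, fun t ht => ha _ (Finset.mem_image_of_mem _ ht) t.2.1 t.2.2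
        fun k => Finset.mem_biUnion.2 ⟨t, ht, Finset.mem_image_of_mem _ (Finset.mem_univ k)⟩⟩
  exact ⟨fun i x => c (i, x), fun γ hγ i hi => hc ⟨⟨γ, hγ⟩, ⟨i, hi⟩⟩⟩

theorem Satisfiable.stretch (h : Γ.Satisfiable M) (hM : M.IsSaturated κ) (hκ : ℵ₀ ≤ κ)
    (hX : #X < κ) (I : Type u) [LinearOrder I] (hI : #I < κ) :
    ∃ b : I → M.Tuple σ, Γ.SatisfiedBy b := by
  obtain ⟨a, ha⟩ := h
  refine exists_satisfiedBy hM hκ hX hI fun Γ₀ hΓ₀ _ F => ?_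
  refine ⟨fun i => a (F.filter (· < i)).card, fun γ hγ i hi hF => ?_⟩
  refine ha γ (hΓ₀ hγ) (fun k => (F.filter (· < i k)).card) fun k l hkl => ?_
  refine Finset.card_lt_card ((Finset.ssubset_iff_of_subset ?_).2 ⟨i k, ?_, ?_⟩)
  · exact Finset.monotone_filter_right F fun x _ hx => hx.trans (hi hkl)
  · exact Finset.mem_filter.2 ⟨hF k, hi hkl⟩
  · simp

theorem Satisfiable.exists_maximal (h : Γ.Satisfiable M) (hM : M.IsSaturated κ) (hκ : ℵ₀ < κ)
    (hX : #X < κ) : ∃ Γ' ⊇ Γ, Maximal (Satisfiable M) Γ' := by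
  refine zorn_subset_nonempty {Δ | Satisfiable M Δ}
    (fun c hc hchain hne => ⟨⋃₀ c, ?_, fun s hs => Set.subset_sUnion_of_mem hs⟩) Γ h
  obtain ⟨b, hb⟩ := exists_satisfiedBy (Γ := ⋃₀ c) (I := ULift.{u} ℕ) hM hκ.le hX
    (by simpa using hκ) fun Γ₀ hΓ₀ hfin F => by
      obtain ⟨Δ, hΔ, hsub⟩ := DirectedOn.exists_mem_subset_of_finite_of_subset_sUnion hne
        hchain.directedOn hfin hΓ₀
      obtain ⟨a, ha⟩ := hc hΔ
      exact ⟨fun i => a i.down, fun γ hγ i hi _ =>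
        ha γ (hsub hγ) (fun k => (i k).down) fun k l hkl => hi hkl⟩
  exact ⟨fun n => b ⟨n⟩, hb.comp (f := ULift.up) fun _ _ h => h⟩

theorem exists_mem_of_maximal (hΓ : Maximal (Satisfiable M) Γ) (hM : M.IsSaturated κ)
    (hX : #X < κ) (hB : B.IsStrongLimit) (hB₀ : ℵ₀ < B) (hBκ : B ≤ κ) {n : ℕ}
    {C : Set (Formula L fun p : Fin n × X => σ p.2)} (hC : #C < B)
    (hcover : ∀ d, ∃ χ ∈ C, M.Realize χ d) : ∃ χ ∈ C, ⟨n, χ⟩ ∈ Γ := by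
  choose color mem_C realize_color using hcover
  obtain ⟨I, _, _, hI, homogeneous_I⟩ :=
    exists_homogeneous hB hC (ULift.{u} ℕ) (by simpa using hB₀) n
  obtain ⟨a, ha⟩ := hΓ.prop.stretch hM (hB₀.le.trans hBκ) hX I (hI.trans_le hBκ)
  obtain ⟨b, χ, hb, hχ⟩ := homogeneous_I fun i => ⟨_, mem_C (Str.select a i)⟩
  have hb' : StrictMono fun k : ℕ => b ⟨k⟩ := fun _ _ h => hb h
  refine ⟨χ, χ.2, hΓ.le_of_ge (y := insert ⟨n, χ⟩ Γ) ⟨a ∘ fun k => b ⟨k⟩, ?_⟩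
    (Set.subset_insert _ _) (Set.mem_insert _ _)⟩
  rintro γ (rfl | hγ) i hi
  · have := hχ (fun k => ⟨i k⟩) fun _ _ h => hi h
    exact this ▸ realize_color (Str.select a fun k => b ⟨i k⟩)
  · exact ha.comp hb' γ hγ i hi

theorem Satisfiable.exists_indiscernible (h : Γ.Satisfiable M) (hT : T.IsEC M)
    (hM : M.IsSaturated κ) (hX : #X < κ) (hB : B.IsStrongLimit) (hB₀ : ℵ₀ < B) (hBκ : B ≤ κ)
    (hL : ∀ n, #(Formula L fun p : Fin n × X => σ p.2) < B) :
    ∃ b : ℕ → M.Tuple σ, Γ.SatisfiedBy b ∧ M.Indiscernible b := by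
  obtain ⟨Γ', hΓ, hmax⟩ := h.exists_maximal hM (hB₀.trans_le hBκ) hX
  obtain ⟨b, hb⟩ := hmax.prop
  refine ⟨b, fun γ hγ => hb γ (hΓ hγ), ?_⟩
  suffices tp_subset : ∀ (n : ℕ) (i j : Fin n → ℕ), StrictMono i → StrictMono j →
      M.tp (Str.select b i) ⊆ M.tp (Str.select b j) from
    fun n i j hi hj => (tp_subset n i j hi hj).antisymm (tp_subset n j i hj hi)
  intro n i j hi hj φ hφ
  -- By existential closedness, each tuple satisfies `φ` or a formula contradicting `φ`.
  obtain ⟨χ, rfl | hcon, hχ⟩ := exists_mem_of_maximal hmax hM hX hB hB₀ hBκ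
    (C := {χ | χ = φ ∨ ∀ d, ¬(M.Realize φ d ∧ M.Realize χ d)}) ((mk_set_le _).trans_lt (hL n))
    fun d => by
      by_cases hd : M.Realize φ d
      · exact ⟨φ, .inl rfl, hd⟩
      · obtain ⟨χ, hχ, hcon⟩ := hT.2 _ _ φ d hd
        exact ⟨χ, .inr (hcon M hT.1), hχ⟩
  · exact hb _ hχ j hj
  · exact (hcon _ ⟨hφ, hb _ hχ i hi⟩).elim

end Pattern

theorem Str.IsSaturated.exists_indiscernible_mem (hM : M.IsSaturated κ) (hT : T.IsEC M)
    (hX : #X < κ) (hB : B.IsStrongLimit) (hB₀ : ℵ₀ < B) (hBκ : B ≤ κ)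
    (hL : ∀ n, #(Formula L fun p : Fin n × X => σ p.2) < B)
    {D : ∀ n, Set (M.Tuple fun p : Fin n × X => σ p.2)} (hD : ∀ n, M.TypeDefinable (D n))
    {a : ℕ → M.Tuple σ} (ha : ∀ n (i : Fin n → ℕ), StrictMono i → Str.select a i ∈ D n) :
    ∃ b : ℕ → M.Tuple σ, M.Indiscernible b ∧
      ∀ n (i : Fin n → ℕ), StrictMono i → Str.select b i ∈ D n := by
  choose Φ hΦ using hD
  simp only [hΦ] at ha ⊢
  let Γ : Pattern L σ := {γ | γ.2 ∈ Φ γ.1}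
  obtain ⟨b, hbΓ, hb⟩ := Pattern.Satisfiable.exists_indiscernible (Γ := Γ)
    ⟨a, fun γ hγ i hi => ha γ.1 i hi γ.2 hγ⟩ hT hM hX hB hB₀ hBκ hL
  exact ⟨b, hb, fun n i hi φ hφ => hbΓ ⟨n, φ⟩ hφ i hi⟩

end Extraction

/-! ### Representatives of hyperimaginaries -/

namespace HypFamily

section Representatives

variable {L : OneSorted.{u}} {H : HypFamily L} {M : Str L} {κ : Cardinal.{u}} {X : Type w}
  {σ : X → HypSort H.Idx}

/-- The lengths of the representatives of the elements of the sorts are bounded below `κ`. -/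
def IsUniformlySmall (H : HypFamily L) (κ : Cardinal.{u}) : Prop :=
  ∃ μ, ℵ₀ ≤ μ ∧ μ < κ ∧ ∀ e, #(H.Len e) ≤ μ

/-- The index set of the real tuples that represent the elements of a sort. -/
def RepLen (H : HypFamily L) : HypSort H.Idx → Type u
  | .real => PUnit
  | .hyp e => H.Len e

/-- The real variables that represent a tuple of variables of sorts `σ`. -/
abbrev RepVar (σ : X → HypSort H.Idx) : Type (max u w) := Σ x, H.RepLen (σ x)

/-- The real tuples that represent tuples of elements of sorts `σ`. -/
abbrev RepTuple (M : Str L) (σ : X → HypSort H.Idx) : Type (max u w) :=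
  M.Tuple fun _ : RepVar σ => PUnit.unit

/-- The element of a sort represented by a real tuple. -/
def cls (hE : H.IsEquiv M) : (s : HypSort H.Idx) → (H.RepLen s → M.carrier PUnit.unit) →
    (str hE).carrier s
  | .real, b => b PUnit.unit
  | .hyp e, b => Quotient.mk (setoid hE e) b

/-- The tuple of elements of `M^𝓔` represented by a real tuple. -/
def clsTuple (hE : H.IsEquiv M) (b : RepTuple M σ) : (str hE).Tuple σ :=
  fun x => cls hE (σ x) fun l => b ⟨x, l⟩

theorem IsUniformlySmall.aleph0_lt (hH : H.IsUniformlySmall κ) : ℵ₀ < κ := by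
  obtain ⟨μ, hμ, hμκ, -⟩ := hH
  exact hμ.trans_lt hμκ

theorem mk_repLen_le {μ : Cardinal.{u}} (hμ : ℵ₀ ≤ μ) (hLen : ∀ e, #(H.Len e) ≤ μ) :
    ∀ s, #(H.RepLen s) ≤ μ
  | .real => mk_punit.le.trans (one_le_aleph0.trans hμ)
  | .hyp e => hLen e

theorem IsUniformlySmall.mk_repLen_lt (hH : H.IsUniformlySmall κ) (s : HypSort H.Idx) :
    #(H.RepLen s) < κ := by
  obtain ⟨μ, hμ, hμκ, hLen⟩ := hH
  exact (mk_repLen_le hμ hLen s).trans_lt hμκ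

theorem mk_repVar_le {μ : Cardinal.{u}} (hμ : ℵ₀ ≤ μ) (hLen : ∀ e, #(H.Len e) ≤ μ)
    (σ : X → HypSort H.Idx) : #(RepVar σ) ≤ lift.{u} #X * lift.{w} μ := by
  rw [mk_sigma, ← sum_const]
  exact sum_le_sum _ _ fun x => mk_repLen_le hμ hLen _

theorem IsUniformlySmall.mk_repVar_lt (hH : H.IsUniformlySmall κ) {X : Type u} (hX : #X < κ)
    (σ : X → HypSort H.Idx) : #(RepVar σ) < κ := by
  obtain ⟨μ, hμ, hμκ, hLen⟩ := hH
  refine (mk_repVar_le hμ hLen σ).trans_lt ?_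
  rw [lift_id, lift_id]
  exact mul_lt_of_lt (hμ.trans hμκ.le) hX hμκ

theorem IsUniformlySmall.mk_repVar_lt_of_finite (hH : H.IsUniformlySmall κ) {X : Type} [Finite X]
    (σ : X → HypSort H.Idx) : #(RepVar σ) < κ := by
  obtain ⟨μ, hμ, hμκ, hLen⟩ := hH
  refine (mk_repVar_le hμ hLen σ).trans_lt ?_
  rw [lift_uzero]
  have hX : lift.{u} #X < κ :=
    (lift_lt_aleph0.2 (lt_aleph0_of_finite X)).trans (hμ.trans_lt hμκ)
  exact mul_lt_of_lt (hμ.trans hμκ.le) hX hμκ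

theorem cls_surjective (hE : H.IsEquiv M) : ∀ s, (cls hE s).Surjective
  | .real => fun c => ⟨fun _ => c, rfl⟩
  | .hyp _ => Quotient.exists_rep

theorem clsTuple_surjective (hE : H.IsEquiv M) : (clsTuple hE (σ := σ)).Surjective := by
  intro c
  choose b hb using fun x => cls_surjective hE (σ x) (c x)
  exact ⟨fun z => b z.1 z.2, funext hb⟩

theorem typeDefinable_cls_eq (hE : H.IsEquiv M) (s : HypSort H.Idx) :
    M.TypeDefinable {w : M.Tuple fun _ : H.RepLen s ⊕ H.RepLen s => PUnit.unit |
      cls hE s (fun l => w (.inl l)) = cls hE s fun l => w (.inr l)} := by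
  cases s with
  | real =>
    exact typeDefinable_realize (M := M) (σ := fun _ : PUnit ⊕ PUnit => PUnit.unit)
      (.equal (s := PUnit.unit) (Term.var (.inl ⟨⟩)).inCtx (Term.var (.inr ⟨⟩)).inCtx)
  | hyp e =>
    refine ⟨H.E e, Set.ext fun w => Quotient.eq.trans (iff_of_eq (congrArg (M.RealizeSet _) ?_))⟩
    exact funext fun z => by cases z <;> rfl

theorem typeDefinable_clsTuple_eq (hE : H.IsEquiv M) (σ : X → HypSort H.Idx) :
    M.TypeDefinable {w : M.Tuple fun _ : RepVar σ ⊕ RepVar σ => PUnit.unit |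
      clsTuple hE (fun z => w (.inl z)) = clsTuple hE fun z => w (.inr z)} := by
  convert Str.TypeDefinable.iInter fun x => (typeDefinable_cls_eq hE (σ x)).reindex
    (σ := fun _ : RepVar σ ⊕ RepVar σ => PUnit.unit) (f := Sum.map (Sigma.mk x) (Sigma.mk x))
  ext w
  simp only [Set.mem_ofPred_eq, Set.mem_iInter]
  exact funext_iff

/-- The real terms that represent a term of `L_𝓔`. -/
def realTerm : {s : HypSort H.Idx} → Term H.lang σ s → H.RepLen s →
    Term L (fun _ : RepVar σ => PUnit.unit) PUnit.unit
  | _, .var x => fun l => .var ⟨x, l⟩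
  | _, .app f ts => fun _ => .app (L := L) f fun i => realTerm (ts i) PUnit.unit

theorem cls_eval_realTerm (hE : H.IsEquiv M) {s : HypSort H.Idx} (t : Term H.lang σ s)
    (b : RepTuple M σ) :
    cls hE s (fun l => M.eval b (realTerm t l)) = (str hE).eval (clsTuple hE b) t := by
  induction t with
  | var x => rfl
  | app f ts ih => exact congrArg (M.func f) (funext ih)

end Representatives

/-! ### Definability in terms of representatives -/

section Pullback

variable {L : OneSorted.{u}} {H : HypFamily L} {M : Str L} {κ : Cardinal.{u}} {X : Type u}
  {σ : X → HypSort H.Idx}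

/-- The variable among the representatives of the arguments of `R_φ` for which a variable of `φ`
stands. -/
def NewRel.repVar (R : H.NewRel) :
    Fin R.n ⊕ (Σ j, H.Len (R.e j)) → RepVar (H.lang.rdom (.inr R))
  | .inl i => ⟨.inl i, PUnit.unit⟩
  | .inr z => ⟨.inr z.1, z.2⟩

theorem str_rel_inr_iff (hE : H.IsEquiv M) (R : H.NewRel)
    (c : (str hE).Tuple (H.lang.rdom (.inr R))) :
    (str hE).rel (.inr R) c ↔ ∃ b : RepTuple M (H.lang.rdom (.inr R)),
      clsTuple hE b = c ∧ M.Realize R.φ fun z => b (R.repVar z) := by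
  constructor
  · rintro ⟨b, hb, hφ⟩
    refine ⟨fun | ⟨.inl i, _⟩ => c (.inl i) | ⟨.inr j, l⟩ => b j l, funext ?_, ?_⟩
    · rintro (i | j)
      · rfl
      · exact hb j
    · convert hφ with z
      cases z <;> rfl
  · rintro ⟨b, rfl, hφ⟩
    refine ⟨fun j l => b ⟨.inr j, l⟩, fun _ => rfl, ?_⟩
    convert hφ with z
    cases z <;> rfl

theorem typeDefinable_rel (hM : M.IsSaturated κ) (hH : H.IsUniformlySmall κ) (hE : H.IsEquiv M)
    (R : H.lang.Rel) :
    M.TypeDefinable {b : RepTuple M (H.lang.rdom R) | (str hE).rel R (clsTuple hE b)} := by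
  have := H.lang.finite_relArg R
  have hsmall := hH.mk_repVar_lt_of_finite (H.lang.rdom R)
  cases R with
  | inl R =>
    exact typeDefinable_realize (M := M) (σ := fun _ : RepVar (H.lang.rdom (.inl R)) => PUnit.unit)
      (.rel R fun i => (Term.var ⟨i, PUnit.unit⟩).inCtx)
  | inr R =>
    convert hM.typeDefinable_exists hsmall hsmall ((typeDefinable_clsTuple_eq hE _).inter
      ((typeDefinable_realize R.φ).reindex (σ := Sum.elim (fun _ => PUnit.unit) fun _ => PUnit.unit)
        (f := fun z => Sum.inr (R.repVar z)))) using 1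
    exact Set.ext fun b =>
      (str_rel_inr_iff hE R _).trans (exists_congr fun b' => and_congr_left' eq_comm)

/-- The variable by which an element of a tuple, or of its extension by a new bound variable, is
represented. -/
def repBound {Γ : List (HypSort H.Idx)} {s : HypSort H.Idx} :
    RepVar (ctx σ (s :: Γ)) → RepVar (ctx σ Γ) ⊕ H.RepLen s
  | ⟨.inl x, l⟩ => .inl ⟨.inl x, l⟩
  | ⟨.inr ⟨0, _⟩, l⟩ => .inr l
  | ⟨.inr ⟨k + 1, h⟩, l⟩ => .inl ⟨.inr ⟨k, Nat.lt_of_succ_lt_succ h⟩, l⟩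

theorem typeDefinable_bRealize_clsTuple (hM : M.IsSaturated κ) (hH : H.IsUniformlySmall κ)
    (hE : H.IsEquiv M) (hX : #X < κ) {Γ : List (HypSort H.Idx)} (φ : BFormula H.lang σ Γ) :
    M.TypeDefinable {b : RepTuple M (ctx σ Γ) |
      (str hE).BRealize (fun x => clsTuple hE b (.inl x)) φ fun k => clsTuple hE b (.inr k)} := by
  have eval_eq {Γ : List (HypSort H.Idx)} {s : HypSort H.Idx} (b : RepTuple M (ctx σ Γ))
      (t : Term H.lang (ctx σ Γ) s) :
      (str hE).eval ((str hE).append (fun x => clsTuple hE b (.inl x)) (τ := Γ.get)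
        fun k => clsTuple hE b (.inr k)) t = cls hE s fun l => M.eval b (realTerm t l) := by
    rw [cls_eval_realTerm]
    exact congrArg (fun v => (str hE).eval v t) (funext fun v => by cases v <;> rfl)
  have hsmall (Γ : List (HypSort H.Idx)) : #(RepVar (ctx σ Γ)) < κ := by
    refine hH.mk_repVar_lt ?_ _
    rw [mk_sum]
    simpa using add_lt_of_lt hH.aleph0_lt.le hX
      ((natCast_lt_aleph0 (n := Γ.length)).trans hH.aleph0_lt)
  induction φ with
  | top => exact typeDefinable_realize .top
  | bot => exact typeDefinable_realize .bot
  | @equal Γ s t₁ t₂ =>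
    convert (typeDefinable_cls_eq hE s).subst (Sum.elim (realTerm t₁) (realTerm t₂)) using 1
    exact Set.ext fun b => iff_of_eq (congrArg₂ Eq (eval_eq b t₁) (eval_eq b t₂))
  | rel R ts =>
    convert (typeDefinable_rel hM hH hE R).subst fun z => realTerm (ts z.1) z.2 using 1
    exact Set.ext fun b =>
      iff_of_eq (congrArg ((str hE).rel R) (funext fun i => eval_eq b (ts i)))
  | and φ ψ ihφ ihψ => exact ihφ.inter ihψ
  | or φ ψ ihφ ihψ => exact ihφ.union ihψ
  | @ex Γ s φ ih =>
    convert hM.typeDefinable_exists (hsmall Γ) (hH.mk_repLen_lt s)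
      (ih.reindex (σ := Sum.elim (fun _ => PUnit.unit) fun _ => PUnit.unit) (f := repBound)) using 1
    ext b
    refine (cls_surjective hE s).exists.trans (exists_congr fun d => iff_of_eq ?_)
    refine congrArg ((str hE).BRealize _ φ) (funext fun k => ?_)
    rcases k with ⟨_ | k, hk⟩ <;> rfl

theorem typeDefinable_realize_clsTuple (hM : M.IsSaturated κ) (hH : H.IsUniformlySmall κ)
    (hE : H.IsEquiv M) (hX : #X < κ) (φ : Formula H.lang σ) :
    M.TypeDefinable {b : RepTuple M σ | (str hE).Realize φ (clsTuple hE b)} := by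
  let f : RepVar (ctx σ []) → RepVar σ
    | ⟨.inl x, l⟩ => ⟨x, l⟩
    | ⟨.inr k, _⟩ => k.elim0
  convert (typeDefinable_bRealize_clsTuple hM hH hE hX φ).reindex (σ := fun _ => PUnit.unit)
    (f := f) using 1
  ext b
  exact iff_of_eq (congrArg ((str hE).BRealize _ φ) (funext fun k => k.elim0))

theorem typeDefinable_preimage_clsTuple (hM : M.IsSaturated κ) (hH : H.IsUniformlySmall κ)
    (hE : H.IsEquiv M) (hX : #X < κ) {D : Set ((str hE).Tuple σ)}
    (hD : (str hE).TypeDefinable D) : M.TypeDefinable (clsTuple hE ⁻¹' D) := by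
  obtain ⟨Φ, rfl⟩ := hD
  convert Str.TypeDefinable.iInter fun φ : Φ => typeDefinable_realize_clsTuple hM hH hE hX φ.1
  ext b
  simp [Str.RealizeSet]

theorem tp_clsTuple_subset (hM : M.IsSaturated κ) (hH : H.IsUniformlySmall κ) (hE : H.IsEquiv M)
    (hX : #X < κ) {a b : RepTuple M σ} (h : M.tp a ⊆ M.tp b) :
    (str hE).tp (clsTuple hE a) ⊆ (str hE).tp (clsTuple hE b) :=
  fun φ hφ => (typeDefinable_realize_clsTuple hM hH hE hX φ).mem_of_tp_subset h hφ

theorem tp_clsTuple_eq (hM : M.IsSaturated κ) (hH : H.IsUniformlySmall κ) (hE : H.IsEquiv M)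
    (hX : #X < κ) {a b : RepTuple M σ} (h : M.tp a = M.tp b) :
    (str hE).tp (clsTuple hE a) = (str hE).tp (clsTuple hE b) :=
  (tp_clsTuple_subset hM hH hE hX h.subset).antisymm (tp_clsTuple_subset hM hH hE hX h.superset)

end Pullback

/-! ### Images of type-definable sets -/

section Image

variable {L : OneSorted.{u}} {H : HypFamily L} {M : Str L} {κ : Cardinal.{u}} {X : Type u}
  {σ : X → HypSort H.Idx}

theorem exists_equiv_fin_sum {ι : Type u} {X : Type*} [Finite X] (σ : X → HypSort ι) :
    ∃ (n m : ℕ) (e : Fin m → ι) (f : Fin n ⊕ Fin m ≃ X),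
      (fun k => σ (f k)) = Sum.elim (fun _ => .real) fun j => .hyp (e j) := by
  classical
  obtain ⟨n, ⟨g⟩⟩ := Finite.exists_equiv_fin {x // σ x = .real}
  obtain ⟨m, ⟨h⟩⟩ := Finite.exists_equiv_fin {x // ¬σ x = .real}
  have exists_hyp (x : {x // ¬σ x = .real}) : ∃ e, σ x = .hyp e := by
    rcases hx : σ x with _ | e
    · exact (x.2 hx).elim
    · exact ⟨e, rfl⟩
  choose e he using exists_hyp
  refine ⟨n, m, fun j => e (h.symm j), (g.symm.sumCongr h.symm).trans (Equiv.sumCompl _), ?_⟩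
  funext k
  rcases k with i | j
  · exact (g.symm i).2
  · exact he (h.symm j)

theorem exists_realize_iff_exists_clsTuple_of_sum (hE : H.IsEquiv M) {n m : ℕ} (e : Fin m → H.Idx)
    {σ : Fin n ⊕ Fin m → HypSort H.Idx} (hσ : σ = Sum.elim (fun _ => .real) fun j => .hyp (e j))
    (ψ : Formula L fun _ : RepVar σ => PUnit.unit) :
    ∃ φ : Formula H.lang σ, ∀ c : (str hE).Tuple σ,
      (str hE).Realize φ c ↔ ∃ b, clsTuple hE b = c ∧ M.Realize ψ b := by
  subst hσ
  let f : RepVar (Sum.elim (fun _ : Fin n => .real) fun j => .hyp (e j)) →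
      Fin n ⊕ (Σ j, H.Len (e j))
    | ⟨.inl i, _⟩ => .inl i
    | ⟨.inr j, l⟩ => .inr ⟨j, l⟩
  let R : H.NewRel := ⟨n, m, e, Formula.rename (σ' := fun _ => PUnit.unit) f ψ⟩
  refine ⟨.rel (L := H.lang) (.inr R) fun i => (Term.var i).inCtx, fun c => ?_⟩
  have realize_iff (b : RepTuple M (H.lang.rdom (.inr R))) :
      M.Realize R.φ (fun z => b (R.repVar z)) ↔ M.Realize ψ b := by
    refine (M.realize_rename _ _ _).trans (iff_of_eq (congrArg (M.Realize ψ) (funext fun z => ?_)))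
    rcases z with ⟨_ | _, _⟩ <;> rfl
  exact (str_rel_inr_iff hE R _).trans (exists_congr fun b => and_congr_right' (realize_iff b))

theorem exists_realize_iff_exists_clsTuple (hE : H.IsEquiv M)
    (ψ : Formula L fun _ : RepVar σ => PUnit.unit) :
    ∃ φ : Formula H.lang σ, ∀ c : (str hE).Tuple σ,
      (str hE).Realize φ c ↔ ∃ b, clsTuple hE b = c ∧ M.Realize ψ b := by
  let A : Set X := Sigma.fst '' ψ.freeVars
  have : Finite A := ψ.finite_freeVars.image _
  obtain ⟨n, m, e, f, hf⟩ := exists_equiv_fin_sum fun x : A => σ x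
  let i (k : Fin n ⊕ Fin m) : X := f k
  have hi : i.Injective := Subtype.val_injective.comp f.injective
  obtain ⟨ψ', hψ'⟩ := ψ.exists_realize_comp
    (fun z : RepVar fun k => σ (i k) => (⟨i z.1, z.2⟩ : RepVar σ)) <| by
      rintro ⟨x, l⟩ hx
      obtain ⟨k, hk⟩ := f.surjective ⟨x, Set.mem_image_of_mem Sigma.fst hx⟩
      obtain rfl : i k = x := congrArg Subtype.val hk
      exact ⟨⟨k, l⟩, rfl⟩
  obtain ⟨φ, hφ⟩ := exists_realize_iff_exists_clsTuple_of_sum hE e hf ψ'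
  refine ⟨Formula.rename i φ, fun c => (Str.realize_rename _ _ _ _).trans ((hφ _).trans ⟨?_, ?_⟩)⟩
  · rintro ⟨b', hb', hψb'⟩
    have (x : X) : Nonempty {d // cls hE (σ x) d = c x} :=
      nonempty_subtype.2 (cls_surjective hE _ _)
    obtain ⟨d, hd⟩ := exists_extend_of_injective (C := fun x => {d // cls hE (σ x) d = c x}) hi
      fun k => ⟨fun l => b' ⟨k, l⟩, congrFun hb' k⟩
    refine ⟨fun z => (d z.1).1 z.2, funext fun x => (d x).2, (hψ' M _).1 ?_⟩
    convert hψb' with z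
    rw [hd]
  · rintro ⟨b, rfl, hψb⟩
    exact ⟨fun z => b ⟨i z.1, z.2⟩, rfl, (hψ' M b).2 hψb⟩

theorem typeDefinable_image_clsTuple (hM : M.IsSaturated κ) (hH : H.IsUniformlySmall κ)
    (hE : H.IsEquiv M) (hX : #X < κ) {D : Set (RepTuple M σ)} (hD : M.TypeDefinable D) :
    (str hE).TypeDefinable (clsTuple hE '' D) := by
  obtain ⟨Φ, rfl⟩ := hD
  have exists_formula (Φ₀ : {Φ₀ // Φ₀ ⊆ Φ ∧ Φ₀.Finite}) : ∃ φ : Formula H.lang σ, ∀ c,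
      (str hE).Realize φ c ↔ ∃ b, clsTuple hE b = c ∧ M.RealizeSet Φ₀ b := by
    obtain ⟨ψ, hψ⟩ := Formula.exists_realize_iff_realizeSet Φ₀.2.2
    simpa only [hψ] using exists_realize_iff_exists_clsTuple hE ψ
  choose φ hφ using exists_formula
  convert Str.TypeDefinable.iInter fun Φ₀ => typeDefinable_realize (M := str hE) (φ Φ₀)
  ext c
  obtain ⟨a, rfl⟩ := clsTuple_surjective hE c
  simp only [Set.mem_iInter, Set.mem_ofPred_eq, hφ, Set.mem_image]
  refine ⟨fun ⟨b, hb, hba⟩ Φ₀ => ⟨b, hba, fun ψ hψ => hb ψ (Φ₀.2.1 hψ)⟩, fun h => ?_⟩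
  have hsmall := hH.mk_repVar_lt hX σ
  obtain ⟨b, hb⟩ := hM.exists_forall_mem hsmall hsmall (fun Φ₀ : {Φ₀ // Φ₀ ⊆ Φ ∧ Φ₀.Finite} =>
    (typeDefinable_clsTuple_eq hE σ).inter ((typeDefinable_realizeSet Φ₀.1).reindex
      (σ := Sum.elim (fun _ => PUnit.unit) fun _ => PUnit.unit) (f := Sum.inr))) a fun s => by
    obtain ⟨b, hba, hb⟩ := h ⟨⋃ Φ₀ ∈ s, Φ₀, Set.iUnion₂_subset fun Φ₀ _ => Φ₀.2.1,
      s.finite_toSet.biUnion fun Φ₀ _ => Φ₀.2.2⟩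
    exact ⟨b, fun Φ₀ hΦ₀ => ⟨hba.symm, fun ψ hψ => hb ψ (Set.mem_biUnion hΦ₀ hψ)⟩⟩
  refine ⟨b, fun ψ hψ => ?_, (hb ⟨∅, Set.empty_subset _, Set.finite_empty⟩).1.symm⟩
  exact (hb ⟨{ψ}, Set.singleton_subset_iff.2 hψ, Set.finite_singleton ψ⟩).2 ψ rfl

end Image

/-! ### Types, saturation and separation in the hyperimaginary extension -/

section Extension

variable {L : OneSorted.{u}} {H : HypFamily L} {T : Theory L} {M : Str L} {κ : Cardinal.{u}}
  {X Y : Type u} {σ : X → HypSort H.Idx} {τ : Y → HypSort H.Idx}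

theorem clsTuple_append (hE : H.IsEquiv M) (a : RepTuple M σ) (b : RepTuple M τ) :
    clsTuple hE (σ := Sum.elim σ τ) (fun z => M.append a b (Equiv.sumSigmaDistrib _ z)) =
      (str hE).append (clsTuple hE a) (clsTuple hE b) :=
  funext fun z => by cases z <;> rfl

theorem isSaturated_str (hM : M.IsSaturated κ) (hH : H.IsUniformlySmall κ) (hE : H.IsEquiv M) :
    (str hE).IsSaturated κ := by
  intro X Y σ τ hX hY Φ c hfin
  obtain ⟨a, rfl⟩ := clsTuple_surjective hE c
  have hXY : #(X ⊕ Y) < κ := by simpa using add_lt_of_lt hH.aleph0_lt.le hX hY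
  obtain ⟨b, hb⟩ := hM.exists_forall_mem (hH.mk_repVar_lt hX σ) (hH.mk_repVar_lt hY τ)
    (fun φ : Φ => (typeDefinable_realize_clsTuple hM hH hE hXY φ.1).reindex
      (σ := Sum.elim (fun _ => PUnit.unit) fun _ => PUnit.unit)
      (f := Equiv.sumSigmaDistrib _)) a fun s => by
    obtain ⟨d, hd⟩ := hfin _ (Subtype.coe_image_subset Φ s) (s.finite_toSet.image _)
    obtain ⟨b, rfl⟩ := clsTuple_surjective hE d
    refine ⟨b, fun φ hφ => ?_⟩
    have := hd φ (Set.mem_image_of_mem _ hφ)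
    rwa [← clsTuple_append] at this
  refine ⟨clsTuple hE b, fun φ hφ => ?_⟩
  rw [← clsTuple_append]
  exact hb ⟨φ, hφ⟩

theorem exists_clsTuple_eq_of_tp_subset (hT : T.IsEC M) (hM : M.IsSaturated κ)
    (hH : H.IsUniformlySmall κ) (hE : H.IsEquiv M) (hX : #X < κ) {a : RepTuple M σ}
    {c : (str hE).Tuple σ} (h : (str hE).tp (clsTuple hE a) ⊆ (str hE).tp c) :
    ∃ b, clsTuple hE b = c ∧ M.tp a = M.tp b := by
  obtain ⟨b, hb, rfl⟩ := (typeDefinable_image_clsTuple hM hH hE hX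
    (typeDefinable_realizeSet (M.tp a))).mem_of_tp_subset h ⟨a, fun _ hφ => hφ, rfl⟩
  exact ⟨b, rfl, hT.tp_eq_of_subset hb⟩

theorem str_tp_eq_of_subset (hT : T.IsEC M) (hM : M.IsSaturated κ) (hH : H.IsUniformlySmall κ)
    (hE : H.IsEquiv M) (hX : #X < κ) {c d : (str hE).Tuple σ}
    (h : (str hE).tp c ⊆ (str hE).tp d) : (str hE).tp c = (str hE).tp d := by
  obtain ⟨a, rfl⟩ := clsTuple_surjective hE c
  obtain ⟨b, rfl, hab⟩ := exists_clsTuple_eq_of_tp_subset hT hM hH hE hX h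
  exact tp_clsTuple_eq hM hH hE hX hab

theorem separated_of_preimage (hE : H.IsEquiv M) {P Q : Set ((str hE).Tuple σ)}
    (h : M.Separated (clsTuple hE ⁻¹' P) (clsTuple hE ⁻¹' Q)) : (str hE).Separated P Q := by
  obtain ⟨φ, ψ, hφ, hψ, hcover⟩ := h
  obtain ⟨φ', hφ'⟩ := exists_realize_iff_exists_clsTuple hE φ
  obtain ⟨ψ', hψ'⟩ := exists_realize_iff_exists_clsTuple hE ψ
  refine ⟨φ', ψ', fun c hc h => ?_, fun c hc h => ?_, fun c => ?_⟩
  · obtain ⟨b, rfl, hb⟩ := (hφ' c).1 h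
    exact hφ b hc hb
  · obtain ⟨b, rfl, hb⟩ := (hψ' c).1 h
    exact hψ b hc hb
  · obtain ⟨b, rfl⟩ := clsTuple_surjective hE c
    exact (hcover b).imp (fun h => (hφ' _).2 ⟨b, rfl, h⟩) fun h => (hψ' _).2 ⟨b, rfl, h⟩

theorem nonempty_hypCarrier (hE : H.IsEquiv M) (h : Nonempty (M.carrier PUnit.unit))
    (s : HypSort H.Idx) : Nonempty (hypCarrier hE s) :=
  ⟨cls hE s fun _ => h.some⟩

end Extension

/-! ### Transfer to the hyperimaginary extension -/

section Transfer

variable {L : OneSorted.{u}} {H : HypFamily L} {T : Theory L} {M : Str L} {κ B : Cardinal.{u}}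
  {X : Type u} {σ : X → HypSort H.Idx}

theorem isHausdorff_extension (hT : T.IsEC M) (hM : M.IsSaturated κ) (hH : H.IsUniformlySmall κ)
    (hE : H.IsEquiv M) (h : T.IsHausdorff κ M) : (extension hE).IsHausdorff κ (str hE) := by
  refine (isSaturated_str hM hH hE).isHausdorff_theory fun X σ hX c d hcd => ?_
  have typeDefinable_preimage (c : (str hE).Tuple σ) :=
    typeDefinable_preimage_clsTuple hM hH hE hX (typeDefinable_realizeSet ((str hE).tp c))
  have hsep : (str hE).Separated {e | (str hE).RealizeSet ((str hE).tp c) e}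
      {e | (str hE).RealizeSet ((str hE).tp d) e} := by
    refine separated_of_preimage hE (hM.separated (hH.mk_repVar_lt hX σ)
      (typeDefinable_preimage c) (typeDefinable_preimage d) fun a ha b hb => ?_)
    refine h.separated hT (hH.mk_repVar_lt hX σ) fun hab => hcd ?_
    calc (str hE).tp c = (str hE).tp (clsTuple hE a) := str_tp_eq_of_subset hT hM hH hE hX ha
      _ = (str hE).tp (clsTuple hE b) := tp_clsTuple_eq hM hH hE hX hab
      _ = (str hE).tp d := (str_tp_eq_of_subset hT hM hH hE hX hb).symm
  exact hsep.mono (Set.singleton_subset_iff.2 fun _ hφ => hφ)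
    (Set.singleton_subset_iff.2 fun _ hφ => hφ)

theorem eqTypes_str (hT : T.IsEC M) (hM : M.IsSaturated κ) (hH : H.IsUniformlySmall κ)
    (hE : H.IsEquiv M) (hX : #X < κ) (σ : X → HypSort H.Idx) :
    (str hE).eqTypes σ = clsTuple hE '' {w : RepTuple M (Sum.elim σ σ) |
      (fun z => w ((Equiv.sumSigmaDistrib _).symm z)) ∈
        M.eqTypes fun _ : RepVar σ => PUnit.unit} := by
  ext w
  constructor
  · intro hw
    obtain ⟨a, ha⟩ := clsTuple_surjective hE (σ := σ) fun x => w (.inl x)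
    obtain ⟨b, hb, hab⟩ := exists_clsTuple_eq_of_tp_subset (σ := σ) hT hM hH hE hX
      (c := fun x => w (.inr x)) (ha ▸ Eq.subset hw)
    refine ⟨fun z => M.append a b (Equiv.sumSigmaDistrib _ z), hab, ?_⟩
    rw [clsTuple_append, ha, hb]
    exact funext fun z => by cases z <;> rfl
  · rintro ⟨w, hw, rfl⟩
    exact tp_clsTuple_eq hM hH hE hX hw

theorem isSemiHausdorff_extension (hT : T.JEP) (hec : T.IsEC M) (hM : M.IsSaturated κ)
    (hH : H.IsUniformlySmall κ) (hE : H.IsEquiv M) (h : T.IsSemiHausdorff κ M) :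
    (extension hE).IsSemiHausdorff κ (str hE) := by
  refine Str.isSemiHausdorff_theory (nonempty_hypCarrier hE (h.nonempty_carrier hT hec
    (one_lt_aleph0.trans hH.aleph0_lt) _)) fun X σ hX => ?_
  have hXX : #(X ⊕ X) < κ := by simpa using add_lt_of_lt hH.aleph0_lt.le hX hX
  rw [eqTypes_str hec hM hH hE hX]
  exact typeDefinable_image_clsTuple hM hH hE hXX
    ((h.typeDefinable_eqTypes (hH.mk_repVar_lt hX σ)).reindex (σ := fun _ => PUnit.unit)
      (f := (Equiv.sumSigmaDistrib _).symm))

/-- The variables that represent the entries of a sequence of tuples. -/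
def repVarProdEquiv (I : Type*) (σ : X → HypSort H.Idx) :
    RepVar (fun p : I × X => σ p.2) ≃ I × RepVar σ where
  toFun z := (z.1.1, ⟨z.1.2, z.2⟩)
  invFun p := ⟨(p.1, p.2.1), p.2.2⟩

theorem mk_prod_lt_of_countable (hκ : ℵ₀ < κ) (hX : #X < κ) {I : Type} [Countable I] :
    #(I × X) < κ := by
  rw [mk_prod, lift_uzero]
  exact mul_lt_of_lt hκ.le ((lift_le_aleph0.2 (mk_le_aleph0 (α := I))).trans_lt hκ) hX

theorem exists_indiscernible_clsTuple_eq (hT : T.IsEC M) (hM : M.IsSaturated κ)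
    (hH : H.IsUniformlySmall κ) (hE : H.IsEquiv M) (hX : #X < κ) (hB : B.IsStrongLimit)
    (hB₀ : ℵ₀ < B) (hBκ : B ≤ κ)
    (hL : ∀ n, #(Formula L fun _ : Fin n × RepVar σ => PUnit.unit) < B)
    {c : ℕ → (str hE).Tuple σ} (hc : (str hE).Indiscernible c) :
    ∃ b : ℕ → RepTuple M σ, M.Indiscernible b ∧ ∀ k, clsTuple hE (b k) = c k := by
  have prod_lt (I : Type) [Countable I] : #(I × X) < κ :=
    mk_prod_lt_of_countable hH.aleph0_lt hX
  let D (n : ℕ) : Set (M.Tuple fun _ : Fin n × RepVar σ => PUnit.unit) :=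
    {v | (str hE).RealizeSet ((str hE).tp (Str.select c ((↑) : Fin n → ℕ)))
      (clsTuple hE fun z => v (repVarProdEquiv (Fin n) σ z))}
  have hD (n : ℕ) : M.TypeDefinable (D n) := by
    have := typeDefinable_preimage_clsTuple hM hH hE (prod_lt (Fin n))
      (typeDefinable_realizeSet ((str hE).tp (Str.select c ((↑) : Fin n → ℕ))))
    exact this.reindex (σ := fun _ : Fin n × RepVar σ => PUnit.unit)
      (f := repVarProdEquiv (Fin n) σ)
  choose a ha using fun k => clsTuple_surjective hE (c k)
  obtain ⟨b, hb, hbD⟩ := hM.exists_indiscernible_mem hT (hH.mk_repVar_lt hX σ) hB hB₀ hBκ hL hD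
    (a := a) fun n i hi => by
      obtain rfl : (fun k => clsTuple hE (a k)) = c := funext ha
      exact (hc n _ i Fin.val_strictMono hi).subset
  have tp_subset : (str hE).tp (σ := fun p : ℕ × X => σ p.2) (fun p => c p.1 p.2) ⊆
      (str hE).tp fun p => clsTuple hE (b p.1) p.2 :=
    Str.tp_subset_of_forall_fin (a := c) (b := fun k => clsTuple hE (b k)) fun n =>
      hbD n _ Fin.val_strictMono
  obtain ⟨b', hb', htp⟩ := exists_clsTuple_eq_of_tp_subset hT hM hH hE (prod_lt ℕ)
    (a := fun z => b (repVarProdEquiv ℕ σ z).1 (repVarProdEquiv ℕ σ z).2)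
    (str_tp_eq_of_subset hT hM hH hE (prod_lt ℕ) tp_subset).superset
  refine ⟨fun k z => b' ((repVarProdEquiv ℕ σ).symm (k, z)), hb.of_tp_eq ?_, fun k => ?_⟩
  · exact Str.tp_comp_eq htp (repVarProdEquiv ℕ σ).symm
  · exact funext fun x => congrFun hb' (k, x)

theorem indiscernibles_str (hT : T.IsEC M) (hM : M.IsSaturated κ)
    (hH : H.IsUniformlySmall κ) (hE : H.IsEquiv M) (hX : #X < κ) (hB : B.IsStrongLimit)
    (hB₀ : ℵ₀ < B) (hBκ : B ≤ κ)
    (hL : ∀ n, #(Formula L fun _ : Fin n × RepVar σ => PUnit.unit) < B) :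
    (str hE).indiscernibles σ = clsTuple hE '' {w : RepTuple M fun p : ℕ × X => σ p.2 |
      (fun p => w ((repVarProdEquiv ℕ σ).symm p)) ∈
        M.indiscernibles fun _ : RepVar σ => PUnit.unit} := by
  ext w
  constructor
  · intro hw
    obtain ⟨b, hb, hbw⟩ := exists_indiscernible_clsTuple_eq hT hM hH hE hX hB hB₀ hBκ hL
      (c := fun k x => w (k, x)) hw
    exact ⟨fun z => b (repVarProdEquiv ℕ σ z).1 (repVarProdEquiv ℕ σ z).2, hb,
      funext fun p => congrFun (hbw p.1) p.2⟩
  · rintro ⟨w, hw, rfl⟩ n i j hi hj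
    exact tp_clsTuple_eq hM hH hE (mk_prod_lt_of_countable hH.aleph0_lt hX)
      (Str.tp_comp_eq (hw n i j hi hj) (repVarProdEquiv (Fin n) σ))

theorem indiscernibles_eq_iInter {S : Type u} {L : Signature S} {M : Str L} (σ : X → S) :
    M.indiscernibles σ = ⋂ A : {A : Set X // A.Finite}, {w | (fun p => w (p.1, p.2)) ∈
      M.indiscernibles fun x : A.1 => σ x} := by
  ext w
  simp only [Set.mem_iInter]
  exact ⟨fun hw A => Str.Indiscernible.comp (a := fun k x => w (k, x)) hw ((↑) : A.1 → X),
    fun h => Str.indiscernible_of_forall_finite (a := fun k x => w (k, x)) fun A hA => h ⟨A, hA⟩⟩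

theorem isThick_extension {μ : Cardinal.{u}} (hμ : ℵ₀ ≤ μ) (hFunc : #L.Func ≤ μ) (hRel : #L.Rel ≤ μ)
    (hLen : ∀ e, #(H.Len e) ≤ μ) (hB : B.IsStrongLimit) (hμB : μ < B) (hBκ : B ≤ κ) (hT : T.JEP)
    (hec : T.IsEC M) (hM : M.IsSaturated κ) (hE : H.IsEquiv M) (h : T.IsThick κ M) :
    (extension hE).IsThick κ (str hE) := by
  have hκ : ℵ₀ < κ := hμ.trans_lt (hμB.trans_le hBκ)
  have hH : H.IsUniformlySmall κ := ⟨μ, hμ, hμB.trans_le hBκ, hLen⟩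
  refine Str.isThick_theory (nonempty_hypCarrier hE (h.nonempty_carrier hT hec
    (one_lt_aleph0.trans hκ) _)) fun X σ _ => ?_
  rw [indiscernibles_eq_iInter]
  refine Str.TypeDefinable.iInter fun A => Str.TypeDefinable.reindex
    (σ := fun p : ℕ × X => σ p.2) (f := fun p : ℕ × A.1 => (p.1, (p.2 : X))) ?_
  have : Finite A.1 := A.2
  have hA : #A.1 < κ := (lt_aleph0_of_finite A.1).trans hκ
  have repVar_le : #(RepVar fun x : A.1 => σ x) ≤ μ := by
    refine (mk_repVar_le hμ hLen _).trans ?_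
    rw [lift_id, lift_id]
    exact mul_le_of_le hμ ((lt_aleph0_of_finite A.1).le.trans hμ) le_rfl
  have formula_lt (n : ℕ) :
      #(Formula L fun _ : Fin n × RepVar (fun x : A.1 => σ x) => PUnit.unit) < B := by
    refine (mk_formula_le _ hμ ?_ hFunc hRel (by simpa using one_le_aleph0.trans hμ)).trans_lt hμB
    rw [mk_prod, lift_uzero]
    exact mul_le_of_le hμ ((lift_le_aleph0.2 mk_le_aleph0).trans hμ) repVar_le
  rw [indiscernibles_str hec hM hH hE hA hB (hμ.trans_lt hμB) hBκ formula_lt]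
  have typeDefinable_indiscernibles := h.typeDefinable_indiscernibles
    (σ := fun _ : RepVar (fun x : A.1 => σ x) => PUnit.unit) (hH.mk_repVar_lt hA _)
  exact typeDefinable_image_clsTuple hM hH hE (mk_prod_lt_of_countable hκ hA)
    (typeDefinable_indiscernibles.reindex (σ := fun _ => PUnit.unit)
      (f := (repVarProdEquiv ℕ (fun x : A.1 => σ x)).symm))

end Transfer

end HypFamily

section Beth

variable {μ : Cardinal.{u}}

theorem isStrongLimit_beth_ord_succ (hμ : ℵ₀ ≤ μ) : (beth (Order.succ μ).ord).IsStrongLimit :=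
  isStrongLimit_beth.2 (isSuccLimit_ord (hμ.trans (Order.le_succ μ))).isSuccPrelimit

theorem lt_beth_ord_succ (μ : Cardinal.{u}) : μ < beth (Order.succ μ).ord :=
  (Order.lt_succ μ).trans_le (le_beth_ord _)

end Beth

end PosLogic

theorem mainTheorem10_general {L : PosLogic.OneSorted.{u}} {T : PosLogic.Theory L}
    {M : PosLogic.Str L} {H : PosLogic.HypFamily L} {κ μ B : Cardinal.{u}}
    (hμ : ℵ₀ ≤ μ) (hFunc : #L.Func ≤ μ) (hRel : #L.Rel ≤ μ) (hLen : ∀ e, #(H.Len e) ≤ μ)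
    (hB : B.IsStrongLimit) (hμB : μ < B) (hBκ : B ≤ κ)
    (hT : T.JEP) (hec : T.IsEC M) (hM : M.IsSaturated κ) (hE : H.IsEquiv M) :
    (T.IsHausdorff κ M →
      (PosLogic.HypFamily.extension hE).IsHausdorff κ (PosLogic.HypFamily.str hE)) ∧
    (T.IsSemiHausdorff κ M →
      (PosLogic.HypFamily.extension hE).IsSemiHausdorff κ (PosLogic.HypFamily.str hE)) ∧
    (T.IsThick κ M →
      (PosLogic.HypFamily.extension hE).IsThick κ (PosLogic.HypFamily.str hE)) := by
  have hH : H.IsUniformlySmall κ := ⟨μ, hμ, hμB.trans_le hBκ, hLen⟩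
  exact ⟨PosLogic.HypFamily.isHausdorff_extension hec hM hH hE,
    PosLogic.HypFamily.isSemiHausdorff_extension hT hec hM hH hE,
    PosLogic.HypFamily.isThick_extension hμ hFunc hRel hLen hB hμB hBκ hT hec hM hE⟩

theorem mainTheorem10 {L : PosLogic.OneSorted.{u}} (T : PosLogic.Theory L)
    (M : PosLogic.Str L) (H : PosLogic.HypFamily L) (κ μ : Cardinal.{u})
    -- `κ`, the bound for smallness, is sufficiently large
    (hμ : ℵ₀ ≤ μ) (hFunc : #L.Func ≤ μ) (hRel : #L.Rel ≤ μ) (hLen : ∀ e, #(H.Len e) ≤ μ)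
    (hκ : Cardinal.beth (Order.succ ((2 : Cardinal.{u}) ^ μ)).ord < κ)
    (hT : T.JEP) (hM : T.IsMonster κ M) (hE : H.IsEquiv M) :
    (T.IsHausdorff κ M →
      (PosLogic.HypFamily.extension hE).IsHausdorff κ (PosLogic.HypFamily.str hE)) ∧
    (T.IsSemiHausdorff κ M →
      (PosLogic.HypFamily.extension hE).IsSemiHausdorff κ (PosLogic.HypFamily.str hE)) ∧
    (T.IsThick κ M →
      (PosLogic.HypFamily.extension hE).IsThick κ (PosLogic.HypFamily.str hE)) := by
  have hμB := (cantor μ).trans (PosLogic.lt_beth_ord_succ (2 ^ μ))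
  have hμκ := hμB.trans hκ
  have hsat : M.IsSaturated κ := hM.isSaturated (hμ.trans_lt hμκ) (hFunc.trans_lt hμκ)
    (hRel.trans_lt hμκ) (by simpa using (one_le_aleph0.trans hμ).trans_lt hμκ)
  exact mainTheorem10_general hμ hFunc hRel hLen
    (PosLogic.isStrongLimit_beth_ord_succ (hμ.trans (cantor μ).le)) hμB hκ.le hT hM.ec hsat hE
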